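/- **Setting.** Let $d\ge 1$ and let $f=\sum_{n\ge1}\sum_{i_1,\dots,i_n=1}^d\alpha_{(i_1,\dots,i_n)}z_{i_1}\cdots z_{i_n}$ and $g=\sum_{n\ge1}\sum_{i_1,\dots,i_n=1}^d\beta_{(i_1,\dots,i_n)}z_{i_1}\cdots z_{i_n}$ be complex polynomials without constant term in non-commuting indeterminates $z_1,\dots,z_d$. Let $\mathcal T=\bigoplus_{n\ge0}(\mathbb C^d)^{\otimes n}$ (Hilbert space direct sum) be the full Fock space over $\mathbb C^d$, with orthonormal basis $e_1,\dots,e_d$ of $\mathbb C^d$ and vacuum vector $\xi_{\rm vac}$ (a unit vector of the summand $n=0$), and let $\varphi_{\rm vac}(T)=\langle T\xi_{\rm vac},\xi_{\rm vac}\rangle$ for $T\in B(\mathcal T)$. Let $S_{i;\ell}=L_i$ and $S_{i;r}=R_i$ be the left and right creation operators, i.e. the isometries of $\mathcal T$ with $L_i\xi_{\rm vac}=R_i\xi_{\rm vac}=e_i$, $L_i(e_{j_1}\otimes\cdots\otimes e_{j_n})=e_i\otimes e_{j_1}\otimes\cdots\otimes e_{j_n}$ and $R_i(e_{j_1}\otimes\cdots\otimes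 e_{j_n})=e_{j_1}\otimes\cdots\otimes e_{j_n}\otimes e_i$. The left and right canonical operators with symbols $f$ and $g$ are $$C_{i;\ell}=L_i^*\Bigl(I+\sum_{n\ge1}\sum_{i_1,\dots,i_n}\alpha_{(i_1,\dots,i_n)}L_{i_n}\cdots L_{i_1}\Bigr),\qquad C_{i;r}=R_i^*\Bigl(I+\sum_{n\ge1}\sum_{i_1,\dots,i_n}\beta_{(i_1,\dots,i_n)}R_{i_n}\cdots R_{i_1}\Bigr).$$ **Bi-mixtures.** For $m\ge1$, $\omega=(i_1,\dots,i_m)\in\{1,\dots,d\}^m$ and $\chi=(h_1,\dots,h_m)\in\{\ell,r\}^m$, let $m_\ell(1)<\cdots<m_\ell(u)$ and $m_r(1)<\cdots<m_r(v)$ be the positions of $\ell$ and of $r$ in $\chi$, and put $$\gamma(\omega;\chi)=\begin{cases}\alpha_{(i_{m_r(v)},\dots,i_{m_r(1)},\,i_{m_\ell(1)},\dots,i_{m_\ell(u)})}&\text{if }h_m=\ell,\\ \beta_{(i_{m_\ell(u)},\dots,i_{m_\ell(1)},\,i_{m_r(1)},\dots,i_{m_r(v)})}&\text{if }h_m=r.\end{cases}$$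 For a non-empty set $T=\{t_1<\cdots<t_m\}$ of positions of a bi-word $(\omega;\chi)$ of length $n$, let $(\omega;\chi)|T=(i_{t_1},\dots,i_{t_m};h_{t_1},\dots,h_{t_m})$. **The set of partitions $\mathcal P^{(\chi)}(n)$.** Let $\chi=(h_1,\dots,h_n)\in\{\ell,r\}^n$. Let $\mathrm{Luk}(n)$ be the set of Lukasiewicz paths with $n$ steps, i.e. paths given by rises $q_1,\dots,q_n\in\{-1,0,1,2,\dots\}$ with $q_1+\cdots+q_m\ge0$ for all $1\le m\le n$ and $q_1+\cdots+q_n=0$. Given $\lambda\in\mathrm{Luk}(n)$, put $p_m=q_m+1$. Balls $1,\dots,n$ sit in an input pipe, in this order from the top, and pass through an initially empty double-ended queue into an output pipe. In the $m$-th move ($m=1,\dots,n$) the top $p_m$ balls of the input pipe are inserted one by one into the queue from the left if $h_m=\ell$, from the right if $h_m=r$, and then the leftmost (if $h_m=\ell$), respectively rightmost (if $h_m=r$), ball of the queue is moved to the output pipe. For each $i$ with $p_i>0$, let $T_i$ be the set of the $p_i$ moves in which the balls inserted in the $i$-th move reach the output pipe. The sets $T_i$ with $p_i>0$ form a partition $\Phi_\chi(\lambda)$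 of $\{1,\dots,n\}$, and $\mathcal P^{(\chi)}(n)=\{\Phi_\chi(\lambda)\mid\lambda\in\mathrm{Luk}(n)\}$. **Proposition 6.10.** For every $n\ge1$, every $\omega=(i_1,\dots,i_n)\in\{1,\dots,d\}^n$ and every $\chi=(h_1,\dots,h_n)\in\{\ell,r\}^n$, $$\varphi_{\rm vac}\bigl(C_{i_1;h_1}\cdots C_{i_n;h_n}\bigr)=\sum_{\pi\in\mathcal P^{(\chi)}(n)}\ \prod_{T\in\pi}\gamma\bigl((\omega;\chi)|T\bigr).$$ -/

import Mathlib

namespace DequeFock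

/-! ### Left and right, restriction of tuples -/

/-- The two symbols `ℓ` (left) and `r` (right). -/
inductive Side where
  | left
  | right
  deriving DecidableEq

/-- The restriction `x | V` of an `n`-tuple `x` to a subset `V = {i₁ < ⋯ < i_m}` of the set of
positions: the `m`-tuple `(x_{i₁}, …, x_{i_m})`. -/
def restrictTuple {X : Type} {n : ℕ} (x : Fin n → X) (V : Finset (Fin n)) : Fin V.card → X :=
  fun k => x (V.orderEmbOfFin rfl k)

/-! ### Lukasiewicz paths and the deque device -/

/-- A Lukasiewicz path with `n` steps, recorded by its rise-vector: every rise is at least `-1`,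
the heights of the path (the partial sums of the rises) are nonnegative and the final height
is `0`. -/
structure LukPath (n : ℕ) where
  rise : Fin n → ℤ
  neg_one_le_rise : ∀ m, -1 ≤ rise m
  height_nonneg : ∀ m, 0 ≤ ∑ k ∈ Finset.Iic m, rise k
  height_last : ∑ k, rise k = 0

/-- The numbers `p_m = rise m + 1 ∈ {0, 1, 2, …}`. -/
def LukPath.p {n : ℕ} (lam : LukPath n) (m : Fin n) : ℕ := (lam.rise m + 1).toNat

/-- A state of the deque device working with the `n` balls `Fin n`. The input and output pipes
are listed from top to bottom, the deque pipe from left to right. -/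
structure DequeState (n : ℕ) where
  input : List (Fin n)
  deque : List (Fin n)
  output : List (Fin n)

/-- At time `0` all the balls are in the input pipe, in increasing order. -/
def DequeState.init (n : ℕ) : DequeState n := ⟨List.finRange n, [], []⟩

/-- The content of the deque pipe after inserting, one by one, the top `p` balls of the
input pipe from the side `h`. -/
def DequeState.loaded {n : ℕ} (s : DequeState n) (p : ℕ) : Side → List (Fin n)
  | .left => (s.input.take p).reverse ++ s.deque
  | .right => s.deque ++ s.input.take p

/-- The left-`p` and right-`p` moves: insert the top `p` balls of the input pipe into the deque
pipe from the given side, then move the ball at that end of the deque pipe to the bottom of the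
output pipe. -/
def DequeState.move {n : ℕ} (s : DequeState n) (p : ℕ) : Side → DequeState n
  | .left => ⟨s.input.drop p, (s.loaded p .left).tail,
      s.output ++ (s.loaded p .left).head?.toList⟩
  | .right => ⟨s.input.drop p, (s.loaded p .right).dropLast,
      s.output ++ (s.loaded p .right).getLast?.toList⟩

/-- The state of the device at time `t`, in the deque-scenario determined by `(lam, chi)`
(nothing moves after time `n`). -/
def dequeState {n : ℕ} (lam : LukPath n) (chi : Fin n → Side) : ℕ → DequeState n
  | 0 => DequeState.init n
  | t + 1 => if h : t < n then
      (dequeState lam chi t).move (lam.p ⟨t, h⟩) (chi ⟨t, h⟩) else dequeState lam chi t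

/-- The number `p_1 + ⋯ + p_t` of balls which left the input pipe during the first `t` moves. -/
def LukPath.inserted {n : ℕ} (lam : LukPath n) (t : ℕ) : ℕ :=
  ∑ k ∈ Finset.univ.filter (fun k : Fin n => k.val < t), lam.p k

/-- The group of balls which leave the input pipe together, in the `i`-th move. -/
def LukPath.group {n : ℕ} (lam : LukPath n) (i : Fin n) : Finset (Fin n) :=
  Finset.univ.filter fun b => lam.inserted i.val ≤ b.val ∧ b.val < lam.inserted (i.val + 1)

/-- The set `T_i` of the moves in which the balls of the `i`-th group arrive in the output pipe
(in every move one ball arrives at the bottom of the output pipe, so that the ball arriving in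
the `t`-th move is the `t`-th one from the top in the final state). -/
def outputTimes {n : ℕ} (lam : LukPath n) (chi : Fin n → Side) (i : Fin n) : Finset (Fin n) :=
  Finset.univ.filter fun t => ∃ b ∈ lam.group i, (dequeState lam chi n).output[t.val]? = some b

section Correctness

variable {n : ℕ} (lam : LukPath n) (chi : Fin n → Side)

theorem LukPath.inserted_zero : lam.inserted 0 = 0 := by
  simp [LukPath.inserted]

theorem LukPath.inserted_succ {t : ℕ} (h : t < n) :
    lam.inserted (t + 1) = lam.inserted t + lam.p ⟨t, h⟩ := by
  have : (Finset.univ.filter fun k : Fin n => k.val < t + 1)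
      = insert ⟨t, h⟩ (Finset.univ.filter fun k : Fin n => k.val < t) := by
    ext k
    simp only [Finset.mem_filter, Finset.mem_univ, true_and, Finset.mem_insert, Fin.ext_iff]
    omega
  rw [LukPath.inserted, this, Finset.sum_insert (by simp), LukPath.inserted, add_comm]

theorem LukPath.inserted_mono : Monotone lam.inserted := by
  intro s t hst
  refine Finset.sum_le_sum_of_subset fun k hk => ?_
  simp only [Finset.mem_filter, Finset.mem_univ, true_and] at hk ⊢
  omega

theorem LukPath.cast_p (m : Fin n) : (lam.p m : ℤ) = lam.rise m + 1 := by
  have := lam.neg_one_le_rise m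
  rw [LukPath.p, Int.toNat_of_nonneg (by omega)]

theorem LukPath.lt_inserted {t : ℕ} (h : t < n) : t < lam.inserted (t + 1) := by
  have h1 := lam.height_nonneg ⟨t, h⟩
  have h2 : (Finset.univ.filter fun k : Fin n => k.val < t + 1) = Finset.Iic ⟨t, h⟩ := by
    ext k
    simp only [Finset.mem_filter, Finset.mem_univ, true_and, Finset.mem_Iic, Fin.le_def]
    omega
  have h3 : (lam.inserted (t + 1) : ℤ) = ∑ k ∈ Finset.Iic ⟨t, h⟩, lam.rise k + (t + 1) := by
    rw [LukPath.inserted, h2]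
    push_cast
    simp [LukPath.cast_p, Finset.sum_add_distrib]
  omega

theorem LukPath.inserted_last : lam.inserted n = n := by
  have h2 : (Finset.univ.filter fun k : Fin n => k.val < n) = Finset.univ := by
    ext k
    simp
  have h3 : (lam.inserted n : ℤ) = n := by
    rw [LukPath.inserted, h2]
    push_cast
    simp [LukPath.cast_p, Finset.sum_add_distrib, lam.height_last]
  exact_mod_cast h3

theorem dequeState_invariant {t : ℕ} (ht : t ≤ n) :
    (dequeState lam chi t).input.length = n - lam.inserted t ∧
    (dequeState lam chi t).output.length = t ∧
    ((dequeState lam chi t).input ++ (dequeState lam chi t).deque ++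
      (dequeState lam chi t).output).Perm (List.finRange n) := by
  induction t with
  | zero => simp [dequeState, DequeState.init, LukPath.inserted_zero]
  | succ t ih =>
    obtain ⟨h1, h2, h3⟩ := ih (by omega)
    have htn : t < n := by omega
    have hlt := lam.lt_inserted htn
    have hs := lam.inserted_succ htn
    rw [dequeState, dif_pos htn]
    set s := dequeState lam chi t with hsdef
    set p := lam.p ⟨t, htn⟩
    have hlen := h3.length_eq
    simp only [List.length_append, List.length_finRange] at hlen
    have hload : ∀ h, (s.input.drop p ++ s.loaded p h ++ s.output).Perm (List.finRange n) := by
      intro h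
      refine List.Perm.trans (List.Perm.append_right _ ?_) h3
      have h4 : (s.input.drop p ++ (s.input.take p ++ s.deque)).Perm (s.input ++ s.deque) := by
        rw [← List.append_assoc]
        refine List.Perm.append_right _ ?_
        refine List.perm_append_comm.trans ?_
        rw [List.take_append_drop]
      cases h with
      | left =>
        exact (List.Perm.append_left _ (List.Perm.append_right _ (List.reverse_perm _))).trans h4
      | right => exact (List.Perm.append_left _ List.perm_append_comm).trans h4
    have hne : ∀ h, s.loaded p h ≠ [] := by
      intro h h0
      have := (hload h).length_eq
      rw [h0] at this
      simp only [List.length_append, List.length_drop, List.length_nil,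
        List.length_finRange] at this
      omega
    cases hc : chi ⟨t, htn⟩ with
    | left =>
      have hl := hload .left
      obtain ⟨b, D, hD⟩ := List.exists_cons_of_ne_nil (hne .left)
      rw [hD] at hl
      simp only [DequeState.move, hD, List.tail_cons, List.head?_cons, Option.toList_some,
        List.length_append, List.length_drop, List.length_cons, List.length_nil]
      refine ⟨by omega, by omega, List.Perm.trans ?_ hl⟩
      rw [List.append_assoc, List.append_assoc]
      refine List.Perm.append_left _ ?_
      rw [List.cons_append, ← List.append_assoc]
      exact List.perm_append_comm
    | right =>
      have hl := hload .right
      have hD := List.dropLast_append_getLast (hne .right)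
      simp only [DequeState.move, List.getLast?_eq_some_getLast (hne .right), Option.toList_some,
        List.length_append, List.length_drop, List.length_cons, List.length_nil]
      refine ⟨by omega, by omega, List.Perm.trans ?_ hl⟩
      have e : s.input.drop p ++ s.loaded p .right ++ s.output = s.input.drop p ++
          ((s.loaded p .right).dropLast ++ [(s.loaded p .right).getLast (hne .right)]) ++
            s.output := by rw [hD]
      rw [e]
      simp only [List.append_assoc]
      exact List.Perm.append_left _ (List.Perm.append_left _ List.perm_append_comm)

theorem final_output :
    (dequeState lam chi n).output.length = n ∧
    (dequeState lam chi n).output.Perm (List.finRange n) := by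
  obtain ⟨_, h2, h3⟩ := dequeState_invariant lam chi le_rfl
  have hlen := h3.length_eq
  simp only [List.length_append, List.length_finRange] at hlen
  have hi : (dequeState lam chi n).input = [] := List.length_eq_zero_iff.1 (by omega)
  have hd : (dequeState lam chi n).deque = [] := List.length_eq_zero_iff.1 (by omega)
  rw [hi, hd] at h3
  exact ⟨h2, by simpa using h3⟩

theorem LukPath.exists_group (b : Fin n) : ∃ i, b ∈ lam.group i := by
  classical
  have hex : ∃ t, b.val < lam.inserted t := ⟨n, by rw [lam.inserted_last]; exact b.2⟩
  obtain ⟨t, ht⟩ : ∃ t, Nat.find hex = t + 1 := by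
    refine Nat.exists_eq_succ_of_ne_zero fun h0 => ?_
    have := Nat.find_spec hex
    rw [h0, lam.inserted_zero] at this
    omega
  have h1 := Nat.find_spec hex
  have h2 : Nat.find hex ≤ n := Nat.find_min' hex (by rw [lam.inserted_last]; exact b.2)
  have h3 := Nat.find_min hex (m := t) (by omega)
  rw [ht] at h1
  refine ⟨⟨t, by omega⟩, ?_⟩
  simp only [LukPath.group, Finset.mem_filter, Finset.mem_univ, true_and]
  omega

theorem LukPath.group_unique {b i j : Fin n} (hi : b ∈ lam.group i) (hj : b ∈ lam.group j) :
    i = j := by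
  simp only [LukPath.group, Finset.mem_filter, Finset.mem_univ, true_and] at hi hj
  rcases lt_trichotomy i.val j.val with h | h | h
  · have := lam.inserted_mono (show i.val + 1 ≤ j.val by omega)
    omega
  · exact Fin.ext h
  · have := lam.inserted_mono (show j.val + 1 ≤ i.val by omega)
    omega

theorem LukPath.group_nonempty_iff {i : Fin n} : (lam.group i).Nonempty ↔ 0 < lam.p i := by
  have hs := lam.inserted_succ i.2
  constructor
  · rintro ⟨b, hb⟩
    simp only [LukPath.group, Finset.mem_filter, Finset.mem_univ, true_and] at hb
    change lam.inserted (i.val + 1) = lam.inserted i.val + lam.p i at hs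
    omega
  · intro hp
    change lam.inserted (i.val + 1) = lam.inserted i.val + lam.p i at hs
    have h1 := lam.inserted_mono (show i.val + 1 ≤ n by omega)
    rw [lam.inserted_last] at h1
    refine ⟨⟨lam.inserted i.val, by omega⟩, ?_⟩
    simp only [LukPath.group, Finset.mem_filter, Finset.mem_univ, true_and]
    omega

end Correctness

/-- The output-time partition `Φ_chi(lam)` associated to the deque-scenario determined by
`(lam, chi)`: its blocks are the sets `T_i` with `p_i > 0`. -/
def outputTimePartition {n : ℕ} (chi : Fin n → Side) (lam : LukPath n) :
    Finpartition (Finset.univ : Finset (Fin n)) :=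
  Finpartition.ofExistsUnique
    ((Finset.univ.filter fun i => 0 < lam.p i).image (outputTimes lam chi))
    (fun _ _ => Finset.subset_univ _)
    (by
      intro t _
      obtain ⟨hlen, _⟩ := final_output lam chi
      have htl : t.val < (dequeState lam chi n).output.length := by rw [hlen]; exact t.2
      obtain ⟨i, hi⟩ := lam.exists_group (dequeState lam chi n).output[t.val]
      refine ⟨outputTimes lam chi i, ⟨?_, ?_⟩, ?_⟩
      · exact Finset.mem_image_of_mem _
          (Finset.mem_filter.2 ⟨Finset.mem_univ _, lam.group_nonempty_iff.1 ⟨_, hi⟩⟩)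
      · exact Finset.mem_filter.2 ⟨Finset.mem_univ _, _, hi, List.getElem?_eq_getElem htl⟩
      · rintro T ⟨hT, htT⟩
        obtain ⟨j, _, rfl⟩ := Finset.mem_image.1 hT
        obtain ⟨_, b, hb, hbt⟩ := Finset.mem_filter.1 htT
        rw [List.getElem?_eq_getElem htl, Option.some_inj] at hbt
        rw [lam.group_unique hi (hbt ▸ hb)])
    (by
      intro h0
      obtain ⟨i, hi, h⟩ := Finset.mem_image.1 h0
      obtain ⟨b, hb⟩ := lam.group_nonempty_iff.2 (Finset.mem_filter.1 hi).2
      obtain ⟨hlen, hperm⟩ := final_output lam chi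
      obtain ⟨t, ht, hbt⟩ := List.mem_iff_getElem.1 (hperm.mem_iff.2 (List.mem_finRange b))
      have : (⟨t, by omega⟩ : Fin n) ∈ outputTimes lam chi i :=
        Finset.mem_filter.2 ⟨Finset.mem_univ _, b, hb, by
          simp only [List.getElem?_eq_getElem ht, hbt]⟩
      rw [h] at this
      simp at this)

/-- The set of partitions `P^(chi)(n) = {Φ_chi(lam) | lam ∈ Luk(n)}`. -/
noncomputable def dequePartitions {n : ℕ} (chi : Fin n → Side) :
    Finset (Finpartition (Finset.univ : Finset (Fin n))) :=
  (Set.toFinite (Set.range (outputTimePartition chi))).toFinset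

/-! ### Full Fock space and creation operators -/

/-- The full Fock space over `ℂ^d`, i.e. the Hilbert space direct sum over `n ≥ 0` of the tensor
powers `(ℂ^d)^{⊗n}`. By means of the orthonormal basis `e_1, …, e_d` of `ℂ^d`, the tensor power
`(ℂ^d)^{⊗n}` is the Euclidean space with orthonormal basis indexed by the words of length `n`. -/
abbrev FockSpace (d : ℕ) : Type :=
  lp (fun n : ℕ => EuclideanSpace ℂ (Fin n → Fin d)) 2

/-- The basis vector `e_{w 0} ⊗ ⋯ ⊗ e_{w (n-1)}`. -/
noncomputable def basisVec {d n : ℕ} (w : Fin n → Fin d) : FockSpace d :=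
  lp.single 2 n (EuclideanSpace.single w 1)

/-- The vacuum vector: the basis vector of the summand `(ℂ^d)^{⊗0} = ℂ`. -/
noncomputable def vacuum (d : ℕ) : FockSpace d := basisVec (Fin.elim0 : Fin 0 → Fin d)

theorem inner_basisVec {d n m : ℕ} (w : Fin n → Fin d) (v : Fin m → Fin d) :
    inner ℂ (basisVec w) (basisVec v)
      = if (⟨n, w⟩ : Σ k, Fin k → Fin d) = ⟨m, v⟩ then (1 : ℂ) else 0 := by
  classical
  rw [basisVec, basisVec, lp.inner_single_left]
  by_cases h : n = m
  · subst h
    simp [EuclideanSpace.inner_single_left]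
  · have : ¬ ((⟨n, w⟩ : Σ k, Fin k → Fin d) = ⟨m, v⟩) := fun h' => h (congrArg Sigma.fst h')
    rw [if_neg this, lp.single_apply_ne _ _ _ h, inner_zero_right]

theorem orthonormal_basisVec_comp {d n m : ℕ} (phi : (Fin n → Fin d) → (Fin m → Fin d))
    (hphi : Function.Injective phi) :
    Orthonormal ℂ fun w => (basisVec (phi w) : FockSpace d) := by
  classical
  rw [orthonormal_iff_ite]
  intro w v
  rw [inner_basisVec]
  simp [hphi.eq_iff]

/-- The isometry `(ℂ^d)^{⊗n} → FockSpace d` with `e_w ↦ e_{phi w}`. -/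
noncomputable def wordIsometry {d n m : ℕ} (phi : (Fin n → Fin d) → (Fin m → Fin d))
    (hphi : Function.Injective phi) : EuclideanSpace ℂ (Fin n → Fin d) →ₗᵢ[ℂ] FockSpace d :=
  ((EuclideanSpace.basisFun (Fin n → Fin d) ℂ).toBasis.constr ℂ
      fun w => (basisVec (phi w) : FockSpace d)).isometryOfOrthonormal
    (v := (EuclideanSpace.basisFun (Fin n → Fin d) ℂ).toBasis)
    (by simp)
    (by
      have : (((EuclideanSpace.basisFun (Fin n → Fin d) ℂ).toBasis.constr ℂ
          fun w => (basisVec (phi w) : FockSpace d)) ∘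
            (EuclideanSpace.basisFun (Fin n → Fin d) ℂ).toBasis)
          = fun w => (basisVec (phi w) : FockSpace d) := by
        funext w
        simp only [Function.comp_apply, Module.Basis.constr_basis]
      rw [this]
      exact orthonormal_basisVec_comp phi hphi)

theorem wordIsometry_apply {d n m : ℕ} (phi : (Fin n → Fin d) → (Fin m → Fin d))
    (hphi : Function.Injective phi) (x : EuclideanSpace ℂ (Fin n → Fin d)) :
    wordIsometry phi hphi x = ∑ w, x w • basisVec (phi w) := by
  change ((EuclideanSpace.basisFun (Fin n → Fin d) ℂ).toBasis.constr ℂ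
      fun w => (basisVec (phi w) : FockSpace d)) x = _
  rw [Module.Basis.constr_apply_fintype]
  simp

theorem orthogonalFamily_wordIsometry {d : ℕ}
    (phi : ∀ n, (Fin n → Fin d) → (Fin (n + 1) → Fin d))
    (hphi : ∀ n, Function.Injective (phi n)) :
    OrthogonalFamily ℂ (fun n : ℕ => EuclideanSpace ℂ (Fin n → Fin d))
      fun n => wordIsometry (phi n) (hphi n) := by
  intro n m hnm x y
  rw [wordIsometry_apply, wordIsometry_apply, sum_inner]
  refine Finset.sum_eq_zero fun w _ => ?_
  rw [inner_sum]
  refine Finset.sum_eq_zero fun v _ => ?_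
  have : ¬ ((⟨n + 1, phi n w⟩ : Σ k, Fin k → Fin d) = ⟨m + 1, phi m v⟩) := fun h' =>
    hnm (Nat.succ_injective (congrArg Sigma.fst h'))
  rw [inner_smul_left, inner_smul_right, inner_basisVec, if_neg this]
  simp

/-- The isometry of the Fock space with `e_w ↦ e_{phi w}` for every word `w`. -/
noncomputable def creation {d : ℕ} (phi : ∀ n, (Fin n → Fin d) → (Fin (n + 1) → Fin d))
    (hphi : ∀ n, Function.Injective (phi n)) : FockSpace d →L[ℂ] FockSpace d :=
  (orthogonalFamily_wordIsometry phi hphi).linearIsometry.toContinuousLinearMap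

theorem creation_basisVec {d : ℕ} (phi : ∀ n, (Fin n → Fin d) → (Fin (n + 1) → Fin d))
    (hphi : ∀ n, Function.Injective (phi n)) {n : ℕ} (w : Fin n → Fin d) :
    creation phi hphi (basisVec w) = basisVec (phi n w) := by
  rw [creation, LinearIsometry.coe_toContinuousLinearMap]
  conv_lhs => rw [basisVec]
  rw [OrthogonalFamily.linearIsometry_apply_single, wordIsometry_apply]
  simp

/-- The left-creation operator `L_i : e_w ↦ e_i ⊗ e_w`. -/
noncomputable def leftCreation {d : ℕ} (i : Fin d) : FockSpace d →L[ℂ] FockSpace d :=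
  creation (fun _ w => Fin.cons i w) (fun _ => Fin.cons_right_injective (α := fun _ => Fin d) i)

/-- The right-creation operator `R_i : e_w ↦ e_w ⊗ e_i`. -/
noncomputable def rightCreation {d : ℕ} (i : Fin d) : FockSpace d →L[ℂ] FockSpace d :=
  creation (fun _ w => Fin.snoc w i) (fun _ => Fin.snoc_left_injective (α := fun _ => Fin d) i)

theorem leftCreation_basisVec {d n : ℕ} (i : Fin d) (w : Fin n → Fin d) :
    leftCreation i (basisVec w) = basisVec (Fin.cons i w : Fin (n + 1) → Fin d) :=
  creation_basisVec _ _ w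

theorem rightCreation_basisVec {d n : ℕ} (i : Fin d) (w : Fin n → Fin d) :
    rightCreation i (basisVec w) = basisVec (Fin.snoc w i : Fin (n + 1) → Fin d) :=
  creation_basisVec _ _ w

/-- The unified notation `S_{i;ℓ} = L_i`, `S_{i;r} = R_i`. -/
noncomputable def creationOp {d : ℕ} (i : Fin d) : Side → (FockSpace d →L[ℂ] FockSpace d)
  | .left => leftCreation i
  | .right => rightCreation i

/-- The vacuum-state `T ↦ ⟨T ξ_vac, ξ_vac⟩`. -/
noncomputable def vacuumState {d : ℕ} (T : FockSpace d →L[ℂ] FockSpace d) : ℂ :=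
  inner ℂ (vacuum d) (T (vacuum d))

/-! ### Canonical operators and bi-mixtures -/

/-- The coefficients `(α_w)` of a polynomial `f` in the non-commuting indeterminates
`z_1, …, z_d`, as a finitely supported function of the word `w`. -/
noncomputable def coeffs {d : ℕ} (f : FreeAlgebra ℂ (Fin d)) : FreeMonoid (Fin d) →₀ ℂ :=
  (FreeAlgebra.equivMonoidAlgebraFreeMonoid f).coeff

/-- The coefficient of `z_{i_1} ⋯ z_{i_n}` in `f`, for the word `[i_1, …, i_n]`. -/
noncomputable def coeffAt {d : ℕ} (f : FreeAlgebra ℂ (Fin d)) (w : List (Fin d)) : ℂ :=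
  coeffs f (FreeMonoid.ofList w)

/-- The operator `S_{i;h}^* (I + ∑ α_{(i_1, …, i_n)} S_{i_n;h} ⋯ S_{i_1;h})`, where the sum is over
the words with nonzero coefficient in the polynomial `f`. -/
noncomputable def canonicalOpOf {d : ℕ} (f : FreeAlgebra ℂ (Fin d)) (i : Fin d) (h : Side) :
    FockSpace d →L[ℂ] FockSpace d :=
  ContinuousLinearMap.adjoint (creationOp i h) *
    (1 + (coeffs f).sum fun w a => a • (w.toList.reverse.map fun j => creationOp j h).prod)

/-- The polynomial which governs the given side: `f` on the left and `g` on the right. -/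
def symbolOf {d : ℕ} (f g : FreeAlgebra ℂ (Fin d)) : Side → FreeAlgebra ℂ (Fin d)
  | .left => f
  | .right => g

/-- The canonical operators `C_{i;ℓ} = A_i` (with symbol `f`) and `C_{i;r} = B_i`
(with symbol `g`). -/
noncomputable def canonicalOp {d : ℕ} (f g : FreeAlgebra ℂ (Fin d)) (i : Fin d) (h : Side) :
    FockSpace d →L[ℂ] FockSpace d :=
  canonicalOpOf (symbolOf f g h) i h

/-- The increasing list `m_h(1) < m_h(2) < ⋯` of the occurrences of `h` in the tuple `chi`. -/
def occurrences {n : ℕ} (chi : Fin n → Side) (h : Side) : List (Fin n) :=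
  (List.finRange n).filter fun m => chi m = h

/-- The bi-mixture `γ(omega; chi)` of a bi-word of length `n ≥ 1`. If the last symbol of `chi` is
`ℓ`, it is the coefficient of `f` at the letters of `omega` in the positions
`m_r(v), …, m_r(1), m_ℓ(1), …, m_ℓ(u)`; if the last symbol is `r`, it is the coefficient
of `g` at the letters in the positions `m_ℓ(u), …, m_ℓ(1), m_r(1), …, m_r(v)`.
(There is no bi-word of length `0`; the value `1` there plays no role.) -/
noncomputable def biMixture {d : ℕ} (f g : FreeAlgebra ℂ (Fin d)) :
    {n : ℕ} → (Fin n → Fin d) → (Fin n → Side) → ℂ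
  | 0, _, _ => 1
  | n + 1, omega, chi =>
    match chi (Fin.last n) with
    | .left =>
        coeffAt f (((occurrences chi .right).reverse ++ occurrences chi .left).map omega)
    | .right =>
        coeffAt g (((occurrences chi .left).reverse ++ occurrences chi .right).map omega)

end DequeFock

open DequeFock

/-! The vacuum expectation is read from the left, with every operator moved onto the bra. Pairing a
basis vector `ket D` with `C_{i;h} y` turns `S_{i;h}^*` into the insertion of the letter `i` into
the word `D` from the side `h`. The series `I + ...` then removes some number `p` of letters from
the same side, with the coefficient of the removed word as amplitude. The expectation is therefore a
sum, over all sequences of removal counts, of the amplitudes of a machine which inserts one letter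
and then removes `p` letters at each time, and which must end empty (`inner_ket_canonicalOp`,
`vacuumState_eq_sum_historyWeight`).

The machine can be run on positions instead of letters. If the positions removed together are the
blocks of a partition, a nonempty block is removed at the time of its maximum, since the position
just inserted lies at the end where the removal takes place. The word removed is the one whose
coefficient is the bi-mixture of the block (`biMixture_restrictTuple`). Conversely, let a partition
be noncrossing for the order `fwdKey`. If the removal counts are the cardinalities of the blocks,
attached to their maxima, then the machine removes exactly these blocks
(`popWord_popRest_arrangement`), so such a partition is determined by its counts
(`eq_of_card_fibre_eq`).

The deque device works in the other direction: it inserts `p` balls and outputs one, and the block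
`T_i` has minimum `i`. Its output-time partitions are noncrossing for `fwdKey` as well
(`isNoncrossing_outputTimePartition`), and distinct paths give distinct partitions
(`outputTimePartition_injective`). Thus the partitions in `dequePartitions chi` inject into the
admissible removal sequences, while reversing a removal sequence gives a Lukasiewicz path, so there
are at most as many removal sequences as partitions. The injection is a bijection, and the two sums
agree term by term (`sum_historyWeight`). -/

namespace DequeFock

/-! ### Words and the deque with labelled letters -/

section Words

variable {X Y : Type*}

/-- Insertion of a letter into a word from the given side. -/
def pushSide : Side → X → List X → List X
  | .left, x, D => x :: D
  | .right, x, D => D ++ [x]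

/-- The last `p` letters which were inserted from the given side, in the order of insertion. -/
def popWord : Side → ℕ → List X → List X
  | .left, p, E => (E.take p).reverse
  | .right, p, E => E.drop (E.length - p)

/-- What remains of a word when `p` letters are removed from the given side. -/
def popRest : Side → ℕ → List X → List X
  | .left, p, E => E.drop p
  | .right, p, E => E.take (E.length - p)

theorem length_pushSide (h : Side) (x : X) (D : List X) :
    (pushSide h x D).length = D.length + 1 := by
  cases h <;> simp [pushSide]

theorem length_popRest (h : Side) (p : ℕ) (E : List X) :
    (popRest h p E).length = E.length - p := by
  cases h <;> simp [popRest]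

theorem length_popWord (h : Side) {p : ℕ} {E : List X} (hp : p ≤ E.length) :
    (popWord h p E).length = p := by
  cases h <;> simp [popWord] <;> omega

theorem map_pushSide (f : X → Y) (h : Side) (x : X) (D : List X) :
    (pushSide h x D).map f = pushSide h (f x) (D.map f) := by
  cases h <;> simp [pushSide]

theorem map_popWord (f : X → Y) (h : Side) (p : ℕ) (E : List X) :
    (popWord h p E).map f = popWord h p (E.map f) := by
  cases h <;> simp [popWord, List.map_take, List.map_drop]

theorem map_popRest (f : X → Y) (h : Side) (p : ℕ) (E : List X) :
    (popRest h p E).map f = popRest h p (E.map f) := by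
  cases h <;> simp [popRest, List.map_take, List.map_drop]

/-- The amplitude of a history of the machine which for every pair `(x, p)` inserts the letter `x`
from its side and then removes `p` letters from the same side, with coefficient `c`. -/
noncomputable def historyWeight (c : Side → List X → ℂ) (side : X → Side) :
    List (X × ℕ) → List X → ℂ
  | [], D => if D.length = 0 then 1 else 0
  | (x, p) :: L, D =>
      if p ≤ D.length + 1 then
        c (side x) (popWord (side x) p (pushSide (side x) x D)) *
          historyWeight c side L (popRest (side x) p (pushSide (side x) x D))
      else 0

end Words

/-! ### Basis vectors and creation operators -/

/-- The basis vector of the Fock space indexed by a word, given as a list. -/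
noncomputable def ket {d : ℕ} (w : List (Fin d)) : FockSpace d := basisVec w.get

theorem basisVec_eq_ket {d n : ℕ} (w : Fin n → Fin d) : basisVec w = ket (List.ofFn w) := by
  have key : ∀ a b : (Σ k, Fin k → Fin d), a = b → basisVec a.2 = basisVec b.2 := by
    rintro a _ rfl
    rfl
  exact key ⟨n, w⟩ ⟨_, (List.ofFn w).get⟩ (List.equivSigmaTuple.right_inv ⟨n, w⟩).symm

theorem inner_ket_ket {d : ℕ} (v w : List (Fin d)) :
    inner ℂ (ket v) (ket w) = if v = w then (1 : ℂ) else 0 := by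
  rw [ket, ket, inner_basisVec]
  congr 1
  exact propext (List.equivSigmaTuple.injective.eq_iff (a := v) (b := w))

theorem vacuum_eq_ket (d : ℕ) : vacuum d = ket [] := by
  rw [vacuum, basisVec_eq_ket]
  simp

theorem creationOp_ket {d : ℕ} (i : Fin d) (h : Side) (w : List (Fin d)) :
    creationOp i h (ket w) = ket (pushSide h i w) := by
  cases h with
  | left =>
    rw [creationOp, ket, leftCreation_basisVec, basisVec_eq_ket, List.ofFn_cons]
    simp [pushSide]
  | right =>
    rw [creationOp, ket, rightCreation_basisVec, basisVec_eq_ket, List.ofFn_succ']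
    simp [pushSide]

theorem inner_creation_creation {d : ℕ} (phi : ∀ n, (Fin n → Fin d) → (Fin (n + 1) → Fin d))
    (hphi : ∀ n, Function.Injective (phi n)) (x y : FockSpace d) :
    inner ℂ (creation phi hphi x) (creation phi hphi y) = inner ℂ x y := by
  rw [creation]
  exact LinearIsometry.inner_map_map _ x y

/-- A general `y` is an infinite sum of its homogeneous components. Continuity of the inner product
reduces the claim to one component, which is a finite combination of basis vectors. -/
theorem inner_ket_creation_eq_zero {d : ℕ}
    (phi : ∀ n, (Fin n → Fin d) → (Fin (n + 1) → Fin d))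
    (hphi : ∀ n, Function.Injective (phi n)) (E : List (Fin d))
    (hE : ∀ n w, List.ofFn (phi n w) ≠ E) (y : FockSpace d) :
    inner ℂ (ket E) (creation phi hphi y) = 0 := by
  have hs := (orthogonalFamily_wordIsometry phi hphi).hasSum_linearIsometry y
  have hs2 := hs.mapL (innerSL ℂ (ket E))
  have h0 : ∀ n, innerSL ℂ (ket E) (wordIsometry (phi n) (hphi n) (y n)) = 0 := by
    intro n
    rw [wordIsometry_apply, map_sum]
    refine Finset.sum_eq_zero fun w _ => ?_
    rw [map_smul, basisVec_eq_ket, innerSL_apply_apply, inner_ket_ket,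
      if_neg (Ne.symm (hE n w)), smul_zero]
  simp only [h0] at hs2
  exact hs2.unique hasSum_zero

theorem inner_creationOp_creationOp {d : ℕ} (i : Fin d) (h : Side) (x y : FockSpace d) :
    inner ℂ (creationOp i h x) (creationOp i h y) = inner ℂ x y := by
  cases h <;> exact inner_creation_creation _ _ x y

theorem inner_ket_creationOp_eq_zero {d : ℕ} (i : Fin d) (h : Side) (E : List (Fin d))
    (hE : ∀ w, pushSide h i w ≠ E) (y : FockSpace d) :
    inner ℂ (ket E) (creationOp i h y) = 0 := by
  cases h with
  | left =>
    refine inner_ket_creation_eq_zero _ _ E (fun n w => ?_) y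
    rw [List.ofFn_cons]
    exact hE _
  | right =>
    refine inner_ket_creation_eq_zero _ _ E (fun n w => ?_) y
    rw [List.ofFn_succ']
    simpa [pushSide] using hE (List.ofFn w)

/-- Insertion of a whole word, letter by letter, from the given side. -/
def pushWord {X : Type*} (h : Side) (w : List X) (D : List X) : List X :=
  w.foldl (fun D x => pushSide h x D) D

theorem pushWord_left {X : Type*} (w D : List X) : pushWord .left w D = w.reverse ++ D := by
  induction w generalizing D with
  | nil => rfl
  | cons x w ih =>
    change pushWord .left w (x :: D) = _
    rw [ih]
    simp

theorem pushWord_right {X : Type*} (w D : List X) : pushWord .right w D = D ++ w := by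
  induction w generalizing D with
  | nil => simp [pushWord]
  | cons x w ih =>
    change pushWord .right w (D ++ [x]) = _
    rw [ih]
    simp

theorem pushWord_popWord {X : Type*} (h : Side) (p : ℕ) (E : List X) :
    pushWord h (popWord h p E) (popRest h p E) = E := by
  cases h with
  | left => simp [pushWord_left, popWord, popRest]
  | right => simp [pushWord_right, popWord, popRest]

theorem popWord_pushWord {X : Type*} (h : Side) (w D : List X) :
    popWord h w.length (pushWord h w D) = w := by
  cases h with
  | left => simp [pushWord_left, popWord]
  | right => simp [pushWord_right, popWord]

theorem length_pushWord {X : Type*} (h : Side) (w D : List X) :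
    (pushWord h w D).length = D.length + w.length := by
  cases h <;> simp [pushWord_left, pushWord_right, add_comm]

theorem prod_creationOp_apply_append {d : ℕ} (h : Side) (w : List (Fin d)) (i : Fin d)
    (y : FockSpace d) :
    ((w ++ [i]).reverse.map fun j => creationOp j h).prod y =
      creationOp i h ((w.reverse.map fun j => creationOp j h).prod y) := by
  simp

theorem pushWord_append_singleton {X : Type*} (h : Side) (w : List X) (x : X) (D : List X) :
    pushWord h (w ++ [x]) D = pushSide h x (pushWord h w D) := by
  simp [pushWord]

/-- The last letter of `w` is both the last one pushed and the outermost factor of the reversed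
product, so the isometries cancel one at a time. -/
theorem inner_ket_pushWord {d : ℕ} (h : Side) (w D : List (Fin d)) (y : FockSpace d) :
    inner ℂ (ket (pushWord h w D)) ((w.reverse.map fun j => creationOp j h).prod y)
      = inner ℂ (ket D) y := by
  induction w using List.reverseRecOn with
  | nil => simp [pushWord]
  | append_singleton w i ih =>
    rw [prod_creationOp_apply_append, pushWord_append_singleton, ← creationOp_ket,
      inner_creationOp_creationOp, ih]

theorem inner_ket_eq_zero_of_ne_pushWord {d : ℕ} (h : Side) (w E : List (Fin d))
    (hE : ∀ D, pushWord h w D ≠ E) (y : FockSpace d) :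
    inner ℂ (ket E) ((w.reverse.map fun j => creationOp j h).prod y) = 0 := by
  induction w using List.reverseRecOn generalizing E with
  | nil => exact absurd rfl (hE E)
  | append_singleton w i ih =>
    rw [prod_creationOp_apply_append]
    by_cases hi : ∃ E', pushSide h i E' = E
    · obtain ⟨E', rfl⟩ := hi
      rw [← creationOp_ket, inner_creationOp_creationOp]
      refine ih E' fun D hD => hE D ?_
      rw [pushWord_append_singleton, hD]
    · push Not at hi
      exact inner_ket_creationOp_eq_zero i h E hi _

/-- The coefficient of a word in the series `1 + f`, respectively `1 + g`. -/
noncomputable def symbolCoeff {d : ℕ} (f g : FreeAlgebra ℂ (Fin d)) (h : Side)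
    (w : List (Fin d)) : ℂ :=
  if w.length = 0 then 1 else coeffAt (symbolOf f g h) w

/-- A word `w` contributes only if `E` arises by pushing `w` onto some word, and then `w` is the
word popped from `E` at its own length. Hence there is one candidate for each length. -/
theorem inner_ket_coeffs_sum {d : ℕ} (f : FreeAlgebra ℂ (Fin d)) (h : Side) (E : List (Fin d))
    (y : FockSpace d) :
    inner ℂ (ket E)
        (((coeffs f).sum fun w a => a • (w.toList.reverse.map fun j => creationOp j h).prod) y)
      = ∑ p ∈ Finset.range (E.length + 1),
          coeffAt f (popWord h p E) * inner ℂ (ket (popRest h p E)) y := by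
  classical
  have hinj : Set.InjOn (fun p => FreeMonoid.ofList (popWord h p E))
      (Finset.range (E.length + 1) : Set ℕ) := by
    intro p hp q hq hpq
    have := congrArg List.length (FreeMonoid.ofList.injective hpq)
    simp only [Finset.coe_range, Set.mem_Iio] at hp hq
    rwa [length_popWord h (by omega), length_popWord h (by omega)] at this
  have hzero : ∀ w : FreeMonoid (Fin d),
      w ∉ (Finset.range (E.length + 1)).image (fun p => FreeMonoid.ofList (popWord h p E)) →
      inner ℂ (ket E) ((w.toList.reverse.map fun j => creationOp j h).prod y) = 0 := by
    intro w hw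
    refine inner_ket_eq_zero_of_ne_pushWord h w.toList E (fun D hD => hw ?_) y
    refine Finset.mem_image.2 ⟨w.toList.length, ?_, ?_⟩
    · rw [← hD, length_pushWord, Finset.mem_range]
      omega
    · rw [← hD, popWord_pushWord, FreeMonoid.ofList_toList]
  rw [Finsupp.sum, _root_.sum_apply, inner_sum]
  simp only [_root_.smul_apply, inner_smul_right]
  -- Support and candidates are compared through their union: off the support the coefficient
  -- vanishes, off the candidates the inner product does.
  rw [Finset.sum_subset (Finset.subset_union_left
      (s₂ := (Finset.range (E.length + 1)).image fun p => FreeMonoid.ofList (popWord h p E))),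
    ← Finset.sum_subset Finset.subset_union_right, Finset.sum_image hinj]
  · refine Finset.sum_congr rfl fun p _ => ?_
    rw [coeffAt]
    congr 1
    conv_lhs => rw [← pushWord_popWord h p E]
    rw [pushWord_popWord, FreeMonoid.toList_ofList]
    have := inner_ket_pushWord h (popWord h p E) (popRest h p E) y
    rwa [pushWord_popWord] at this
  · intro w _ hw
    rw [hzero w hw, mul_zero]
  · intro w _ hw
    rw [Finsupp.notMem_support_iff.1 hw, zero_mul]

/-! ### The vacuum expectation as a sum over histories -/

theorem coeffAt_symbolOf_nil {d : ℕ} {f g : FreeAlgebra ℂ (Fin d)} (hf : coeffAt f [] = 0)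
    (hg : coeffAt g [] = 0) (h : Side) : coeffAt (symbolOf f g h) [] = 0 := by
  cases h <;> assumption

/-- The adjoint of the creation operator inserts `i` into the bra. Since the symbols have no
constant term, the summand `p = 0` comes from the identity alone, in accordance with the value `1`
of `symbolCoeff` at the empty word. -/
theorem inner_ket_canonicalOp {d : ℕ} {f g : FreeAlgebra ℂ (Fin d)} (hf : coeffAt f [] = 0)
    (hg : coeffAt g [] = 0) (i : Fin d) (h : Side) (D : List (Fin d)) (y : FockSpace d) :
    inner ℂ (ket D) (canonicalOp f g i h y)
      = ∑ p ∈ Finset.range (D.length + 2), symbolCoeff f g h (popWord h p (pushSide h i D)) *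
          inner ℂ (ket (popRest h p (pushSide h i D))) y := by
  rw [canonicalOp, canonicalOpOf, mul_apply_eq_comp,
    ContinuousLinearMap.adjoint_inner_right, creationOp_ket, _root_.add_apply,
    inner_add_right, inner_ket_coeffs_sum, one_apply_eq_self, length_pushSide,
    Finset.sum_range_succ', Finset.sum_range_succ' _ (D.length + 1)]
  set E := pushSide h i D with hE
  have hlen : E.length = D.length + 1 := length_pushSide h i D
  have h0 : popWord h 0 E = [] := List.length_eq_zero_iff.1 (length_popWord h (Nat.zero_le _))
  have h1 : popRest h 0 E = E := by cases h <;> simp [popRest]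
  rw [h0, h1, coeffAt_symbolOf_nil hf hg, zero_mul, add_zero, add_comm]
  congr 1
  · refine Finset.sum_congr rfl fun p hp => ?_
    rw [Finset.mem_range] at hp
    rw [symbolCoeff, length_popWord h (by omega), if_neg (by omega)]
  · simp [symbolCoeff]

/-- Labels in `X` replace letters, so that distinct positions with equal letters stay
distinguishable. The uniform bound `B` lets the removal counts range over a fixed product; counts
exceeding the content of the machine have weight `0`. -/
theorem inner_ket_prod_canonicalOp {d : ℕ} {f g : FreeAlgebra ℂ (Fin d)} (hf : coeffAt f [] = 0)
    (hg : coeffAt g [] = 0) {X : Type*} (omega : X → Fin d) (side : X → Side) (B : ℕ)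
    (ts : List X) (D : List X) (k : ℕ) (hk : ts.length = k) (hB : D.length + k < B) :
    inner ℂ (ket (D.map omega))
        ((ts.map fun x => canonicalOp f g (omega x) (side x)).prod (vacuum d))
      = ∑ q : Fin k → Fin B,
          historyWeight (fun h w => symbolCoeff f g h (w.map omega)) side
            (ts.zip (List.ofFn fun j => (q j : ℕ))) D := by
  induction ts generalizing D k with
  | nil =>
    subst hk
    simp only [List.map_nil, List.prod_nil, one_apply_eq_self, List.length_nil,
      vacuum_eq_ket, inner_ket_ket, List.map_eq_nil_iff]
    simp [historyWeight]
  | cons x ts ih =>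
    obtain ⟨k, rfl⟩ : ∃ l, k = l + 1 := ⟨ts.length, by simpa using hk.symm⟩
    simp only [List.length_cons, add_left_inj] at hk
    rw [List.map_cons, List.prod_cons, mul_apply_eq_comp,
      inner_ket_canonicalOp hf hg,
      ← Fintype.sum_equiv (Fin.consEquiv fun _ : Fin (k + 1) => Fin B)
        (fun z => historyWeight (fun h w => symbolCoeff f g h (w.map omega)) side
            ((x :: ts).zip (List.ofFn fun j => ((Fin.cons z.1 z.2 : Fin (k + 1) → Fin B) j : ℕ)))
              D) _ (fun _ => rfl),
      Fintype.sum_prod_type, List.length_map]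
    have hstep : ∀ (p : Fin B) (q : Fin k → Fin B),
        historyWeight (fun h w => symbolCoeff f g h (w.map omega)) side
            ((x :: ts).zip (List.ofFn fun j => ((Fin.cons p q : Fin (k + 1) → Fin B) j : ℕ))) D
          = historyWeight (fun h w => symbolCoeff f g h (w.map omega)) side
            ((x, (p : ℕ)) :: ts.zip (List.ofFn fun j => (q j : ℕ))) D := by
      intro p q
      rw [List.ofFn_succ]
      simp
    simp only [hstep, historyWeight]
    rw [Fin.sum_univ_eq_sum_range (fun p => ∑ q : Fin k → Fin B,
      if p ≤ D.length + 1 then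
        symbolCoeff f g (side x)
            (List.map omega (popWord (side x) p (pushSide (side x) x D))) *
          historyWeight (fun h w => symbolCoeff f g h (w.map omega)) side
            (ts.zip (List.ofFn fun j => (q j : ℕ)))
            (popRest (side x) p (pushSide (side x) x D))
      else 0) B]
    have hsub : Finset.range (D.length + 2) ⊆ Finset.range B := by
      intro p hp
      rw [Finset.mem_range] at hp ⊢
      omega
    rw [← Finset.sum_subset hsub]
    · refine Finset.sum_congr rfl fun p hp => ?_
      rw [Finset.mem_range] at hp
      simp only [if_pos (show p ≤ D.length + 1 by omega)]
      rw [← Finset.mul_sum, ← map_pushSide, ← map_popWord, ← map_popRest,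
        ih _ k hk (by rw [length_popRest, length_pushSide]; omega)]
    · intro p _ hp
      rw [Finset.mem_range] at hp
      simp only [if_neg (show ¬ p ≤ D.length + 1 by omega)]
      simp

theorem vacuumState_eq_sum_historyWeight {d : ℕ} {f g : FreeAlgebra ℂ (Fin d)}
    (hf : coeffAt f [] = 0) (hg : coeffAt g [] = 0) {n : ℕ} (omega : Fin n → Fin d)
    (chi : Fin n → Side) :
    vacuumState (List.ofFn fun k => canonicalOp f g (omega k) (chi k)).prod
      = ∑ q : Fin n → Fin (n + 1),
          historyWeight (fun h w => symbolCoeff f g h (w.map omega)) chi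
            ((List.finRange n).map fun t => (t, (q t : ℕ))) [] := by
  have h := inner_ket_prod_canonicalOp hf hg omega chi (n + 1) (List.finRange n) [] n
    (List.length_finRange) (by simp)
  rw [List.map_nil, ← vacuum_eq_ket, ← List.ofFn_eq_map] at h
  rw [vacuumState, h]
  refine Finset.sum_congr rfl fun q _ => ?_
  congr 1
  refine List.ext_getElem (by simp) fun k _ _ => ?_
  simp

/-! ### The two orders on positions and noncrossing partitions -/

section Orders

variable {n : ℕ} (chi : Fin n → Side)

/-- The key of the order on positions in which the left positions come first, increasingly, and
are followed by the right positions, decreasingly. -/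
def fwdKey (t : Fin n) : ℤ :=
  match chi t with
  | .left => t - n
  | .right => n - t

/-- The key of the order on positions in which the left positions come first, decreasingly, and
are followed by the right positions, increasingly. -/
def bwdKey (t : Fin n) : ℤ :=
  match chi t with
  | .left => -t - 1
  | .right => t

theorem fwdKey_of_left {t : Fin n} (h : chi t = .left) : fwdKey chi t = t - n := by
  simp [fwdKey, h]

theorem fwdKey_of_right {t : Fin n} (h : chi t = .right) : fwdKey chi t = n - t := by
  simp [fwdKey, h]

theorem bwdKey_of_left {t : Fin n} (h : chi t = .left) : bwdKey chi t = -t - 1 := by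
  simp [bwdKey, h]

theorem bwdKey_of_right {t : Fin n} (h : chi t = .right) : bwdKey chi t = t := by
  simp [bwdKey, h]

theorem Side.eq_left_or_eq_right (h : Side) : h = .left ∨ h = .right := by
  cases h <;> simp

/-- The elements of `S`, listed in the increasing order of their backward keys: this is the
content of a deque in which the elements of `S` have been inserted from their sides. -/
def arrangement (S : Finset (Fin n)) : List (Fin n) :=
  ((List.finRange n).filter fun x => x ∈ S ∧ chi x = .left).reverse ++
    (List.finRange n).filter fun x => x ∈ S ∧ chi x = .right

theorem mem_arrangement {S : Finset (Fin n)} {x : Fin n} : x ∈ arrangement chi S ↔ x ∈ S := by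
  rcases (chi x).eq_left_or_eq_right with h | h <;> simp [arrangement, h]

theorem pairwise_arrangement (S : Finset (Fin n)) :
    (arrangement chi S).Pairwise fun x y => bwdKey chi x < bwdKey chi y := by
  rw [arrangement, List.pairwise_append, List.pairwise_reverse]
  refine ⟨?_, ?_, ?_⟩
  · refine ((List.pairwise_lt_finRange n).filter _).imp_of_mem ?_
    intro a b ha hb hab
    simp only [List.mem_filter, List.mem_finRange, true_and, decide_eq_true_eq] at ha hb
    rw [bwdKey_of_left chi ha.2, bwdKey_of_left chi hb.2]
    omega
  · refine ((List.pairwise_lt_finRange n).filter _).imp_of_mem ?_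
    intro a b ha hb hab
    simp only [List.mem_filter, List.mem_finRange, true_and, decide_eq_true_eq] at ha hb
    rw [bwdKey_of_right chi ha.2, bwdKey_of_right chi hb.2]
    omega
  · intro a ha b hb
    simp only [List.mem_reverse, List.mem_filter, List.mem_finRange, true_and,
      decide_eq_true_eq] at ha hb
    rw [bwdKey_of_left chi ha.2, bwdKey_of_right chi hb.2]
    omega

theorem eq_of_pairwise_key_lt {X : Type*} (key : X → ℤ) {l₁ l₂ : List X}
    (h₁ : l₁.Pairwise fun x y => key x < key y) (h₂ : l₂.Pairwise fun x y => key x < key y)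
    (h : ∀ x, x ∈ l₁ ↔ x ∈ l₂) : l₁ = l₂ := by
  have hd : ∀ {l : List X}, (l.Pairwise fun x y => key x < key y) → l.Nodup := by
    intro l hl
    refine hl.imp ?_
    rintro a b hab rfl
    exact lt_irrefl _ hab
  refine List.Perm.eq_of_pairwise ?_ h₁ h₂ ((List.perm_ext_iff_of_nodup (hd h₁) (hd h₂)).2 h)
  intro a b _ _ hab hba
  omega

theorem eq_arrangement {S : Finset (Fin n)} {l : List (Fin n)}
    (hl : l.Pairwise fun x y => bwdKey chi x < bwdKey chi y) (h : ∀ x, x ∈ l ↔ x ∈ S) :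
    l = arrangement chi S :=
  eq_of_pairwise_key_lt (bwdKey chi) hl (pairwise_arrangement chi S) fun x => by
    rw [h, mem_arrangement]

theorem length_arrangement (S : Finset (Fin n)) : (arrangement chi S).length = S.card := by
  have hd : (arrangement chi S).Nodup := by
    refine (pairwise_arrangement chi S).imp ?_
    rintro a b hab rfl
    exact lt_irrefl _ hab
  rw [← List.toFinset_card_of_nodup hd]
  congr 1
  ext x
  simp [mem_arrangement]

/-- The word spelled by a block whose elements are removed together from the given side. -/
def blockWord (h : Side) (S : Finset (Fin n)) : List (Fin n) :=
  match h with
  | .left => (arrangement chi S).reverse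
  | .right => arrangement chi S

/-- A position later than all of `S` is extremal in the backward order, at the end given by its own
side. -/
theorem pushSide_arrangement (m : Fin n) (S : Finset (Fin n)) (hS : ∀ x ∈ S, x < m) :
    pushSide (chi m) m (arrangement chi S) = arrangement chi (insert m S) := by
  rcases (chi m).eq_left_or_eq_right with h | h
  · rw [h]
    refine eq_arrangement chi ?_ fun x => ?_
    · rw [pushSide, List.pairwise_cons]
      refine ⟨fun x hx => ?_, pairwise_arrangement chi S⟩
      have := hS x ((mem_arrangement chi).1 hx)
      rw [bwdKey_of_left chi h]
      rcases (chi x).eq_left_or_eq_right with h' | h'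
      · rw [bwdKey_of_left chi h']
        omega
      · rw [bwdKey_of_right chi h']
        omega
    · simp [pushSide, mem_arrangement]
  · rw [h]
    refine eq_arrangement chi ?_ fun x => ?_
    · rw [pushSide, List.pairwise_append]
      refine ⟨pairwise_arrangement chi S, List.pairwise_singleton _ _, fun x hx y hy => ?_⟩
      rw [List.mem_singleton] at hy
      subst hy
      have := hS x ((mem_arrangement chi).1 hx)
      rw [bwdKey_of_right chi h]
      rcases (chi x).eq_left_or_eq_right with h' | h'
      · rw [bwdKey_of_left chi h']
        omega
      · rw [bwdKey_of_right chi h']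
        omega
    · simp [pushSide, mem_arrangement, or_comm]

theorem arrangement_union {S T : Finset (Fin n)}
    (h : ∀ x ∈ S, ∀ y ∈ T, bwdKey chi x < bwdKey chi y) :
    arrangement chi (S ∪ T) = arrangement chi S ++ arrangement chi T := by
  symm
  refine eq_arrangement chi ?_ fun x => by simp [mem_arrangement]
  rw [List.pairwise_append]
  refine ⟨pairwise_arrangement chi S, pairwise_arrangement chi T, fun x hx y hy => ?_⟩
  exact h x ((mem_arrangement chi).1 hx) y ((mem_arrangement chi).1 hy)

/-! ### Noncrossing partitions and the run of the machine -/

/-- A partition of the positions, given by the map sending a position to the maximum of its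
block. -/
structure IsBlockMax (bm : Fin n → Fin n) : Prop where
  le : ∀ x, x ≤ bm x
  idem : ∀ x, bm (bm x) = bm x

/-- The partition of the positions into the fibres of `bm` is noncrossing for the forward order. -/
def IsNoncrossing (bm : Fin n → Fin n) : Prop :=
  ∀ a b c d, fwdKey chi a < fwdKey chi b → fwdKey chi b < fwdKey chi c →
    fwdKey chi c < fwdKey chi d → bm a = bm c → bm b = bm d → bm a = bm b

/-- The block with maximum `m` (empty if there is no such block). -/
def fibre (bm : Fin n → Fin n) (m : Fin n) : Finset (Fin n) :=
  Finset.univ.filter fun x => bm x = m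

/-- The positions before `m` whose block is not yet completed before `m`. -/
def pending (bm : Fin n → Fin n) (m : ℕ) : Finset (Fin n) :=
  Finset.univ.filter fun x => x.val < m ∧ m ≤ (bm x).val

theorem mem_fibre {bm : Fin n → Fin n} {m x : Fin n} : x ∈ fibre bm m ↔ bm x = m := by
  simp [fibre]

theorem mem_pending {bm : Fin n → Fin n} {m : ℕ} {x : Fin n} :
    x ∈ pending bm m ↔ x.val < m ∧ m ≤ (bm x).val := by
  simp [pending]

variable {chi} {bm : Fin n → Fin n}

theorem insert_pending (hb : IsBlockMax bm) (m : Fin n) :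
    insert m (pending bm m) = fibre bm m ∪ pending bm (m + 1) := by
  ext x
  simp only [Finset.mem_insert, Finset.mem_union, mem_fibre, mem_pending, Fin.ext_iff]
  have := hb.le x
  rw [Fin.le_def] at this
  have hm : x.val = m.val → (bm x).val = (bm m).val := fun h => by rw [Fin.ext h]
  have := hb.le m
  rw [Fin.le_def] at this
  omega

/-- Up to a cyclic rotation the backward order is the reverse of the forward order, so both have the
same crossings. At time `m` the position `m` is extremal on its side among those inserted. If `s`
lay between `m` and `x`, the later position `bm s`, which is beyond all of them at one end, would
make the pairs `m, x` and `s, bm s` cross. -/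
theorem not_bwdKey_crossing (hb : IsBlockMax bm) (hnc : IsNoncrossing chi bm) {m x s : Fin n}
    (hx : x ∈ fibre bm m) (hs : s ∈ pending bm (m + 1)) :
    ¬ ((chi m = .left ∧ bwdKey chi s ≤ bwdKey chi x) ∨
      (chi m = .right ∧ bwdKey chi x ≤ bwdKey chi s)) := by
  rw [mem_fibre] at hx
  rw [mem_pending] at hs
  have hxm : x ≤ m := hx ▸ hb.le x
  have hmm : bm m = m := by rw [← hx, hb.idem]
  have hsm : s ≠ m := by
    rintro rfl
    rw [hmm] at hs
    omega
  have hsx : s ≠ x := by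
    rintro rfl
    rw [hx] at hs
    omega
  have hyy : bm (bm s) = bm s := hb.idem s
  obtain ⟨y, hy⟩ : ∃ y, y = bm s := ⟨_, rfl⟩
  rw [← hy] at hyy hs
  have hmy : m ≠ y := by
    rintro rfl
    omega
  have cross₁ : ∀ a b c d, fwdKey chi a < fwdKey chi b → fwdKey chi b < fwdKey chi c →
      fwdKey chi c < fwdKey chi d → bm a = m → bm c = m → bm b = y → bm d = y → False :=
    fun a b c d h₁ h₂ h₃ ha hc hb' hd =>
      hmy (ha ▸ hb' ▸ hnc a b c d h₁ h₂ h₃ (ha.trans hc.symm) (hb'.trans hd.symm))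
  have cross₂ : ∀ a b c d, fwdKey chi a < fwdKey chi b → fwdKey chi b < fwdKey chi c →
      fwdKey chi c < fwdKey chi d → bm a = y → bm c = y → bm b = m → bm d = m → False :=
    fun a b c d h₁ h₂ h₃ ha hc hb' hd =>
      hmy (ha ▸ hb' ▸ hnc a b c d h₁ h₂ h₃ (ha.trans hc.symm) (hb'.trans hd.symm)).symm
  have hkey : ∀ t, (chi t = .left ∧ fwdKey chi t = t - n ∧ bwdKey chi t = -t - 1) ∨
      (chi t = .right ∧ fwdKey chi t = n - t ∧ bwdKey chi t = t) := by
    intro t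
    rcases (chi t).eq_left_or_eq_right with h | h
    · exact Or.inl ⟨h, fwdKey_of_left chi h, bwdKey_of_left chi h⟩
    · exact Or.inr ⟨h, fwdKey_of_right chi h, bwdKey_of_right chi h⟩
  have := y.2
  rintro (⟨h, hlt⟩ | ⟨h, hlt⟩)
  · have k1 := fwdKey_of_left chi h
    have k1' := bwdKey_of_left chi h
    -- The sides of `x`, `s` and `y` decide where the cyclic order is cut, hence which of the four
    -- positions comes first in the forward order.
    rcases hkey x with ⟨-, k2, k2'⟩ | ⟨-, k2, k2'⟩ <;>
      rcases hkey s with ⟨-, k3, k3'⟩ | ⟨-, k3, k3'⟩ <;>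
      rcases hkey y with ⟨-, k4, k4'⟩ | ⟨-, k4, k4'⟩ <;>
      first
      | omega
      | exact cross₁ x s m y (by omega) (by omega) (by omega) hx hmm hy.symm hyy
      | exact cross₂ s m y x (by omega) (by omega) (by omega) hy.symm hyy hmm hx
      | exact cross₁ m y x s (by omega) (by omega) (by omega) hmm hx hyy hy.symm
  · have k1 := fwdKey_of_right chi h
    have k1' := bwdKey_of_right chi h
    rcases hkey x with ⟨-, k2, k2'⟩ | ⟨-, k2, k2'⟩ <;>
      rcases hkey s with ⟨-, k3, k3'⟩ | ⟨-, k3, k3'⟩ <;>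
      rcases hkey y with ⟨-, k4, k4'⟩ | ⟨-, k4, k4'⟩ <;>
      first
      | omega
      | exact cross₂ y m s x (by omega) (by omega) (by omega) hyy hy.symm hmm hx
      | exact cross₁ x y m s (by omega) (by omega) (by omega) hx hmm hyy hy.symm
      | exact cross₂ s x y m (by omega) (by omega) (by omega) hy.symm hyy hx hmm

/-- By `not_bwdKey_crossing` the block with maximum `m` occupies a full segment of the content at
the end on the side of `m`, so removing as many positions as it has removes exactly this block. If
`m` is not a block maximum, nothing is removed. -/
theorem popWord_popRest_arrangement (hb : IsBlockMax bm) (hnc : IsNoncrossing chi bm)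
    (m : Fin n) :
    popWord (chi m) (fibre bm m).card (pushSide (chi m) m (arrangement chi (pending bm m)))
        = blockWord chi (chi m) (fibre bm m) ∧
      popRest (chi m) (fibre bm m).card (pushSide (chi m) m (arrangement chi (pending bm m)))
        = arrangement chi (pending bm (m + 1)) := by
  rw [pushSide_arrangement chi m _ fun x hx => (mem_pending.1 hx).1, insert_pending hb]
  have hcross := fun x s (hx : x ∈ fibre bm m) (hs : s ∈ pending bm (m + 1)) =>
    not_bwdKey_crossing hb hnc hx hs
  rcases (chi m).eq_left_or_eq_right with h | h
  · rw [arrangement_union chi fun x hx y hy => not_le.1 fun hle =>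
      hcross x y hx hy (Or.inl ⟨h, hle⟩), h]
    simp [popWord, popRest, blockWord, ← length_arrangement chi]
  · rw [Finset.union_comm, arrangement_union chi fun x hx y hy => not_le.1 fun hle =>
      hcross y x hy hx (Or.inr ⟨h, hle⟩), h]
    simp [popWord, popRest, blockWord, ← length_arrangement chi]

theorem card_fibre_le (hb : IsBlockMax bm) (m : Fin n) :
    (fibre bm m).card ≤ (pending bm m).card + 1 := by
  refine le_trans (Finset.card_le_card ?_) (Finset.card_insert_le m (pending bm m))
  rw [insert_pending hb]
  exact Finset.subset_union_left

theorem pending_last (bm : Fin n → Fin n) : pending bm n = ∅ := by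
  ext x
  have := (bm x).2
  simp only [mem_pending, Finset.notMem_empty, iff_false]
  omega

theorem pending_zero (bm : Fin n → Fin n) : pending bm 0 = ∅ := by
  ext x
  simp [mem_pending]

theorem historyWeight_arrangement (hb : IsBlockMax bm) (hnc : IsNoncrossing chi bm)
    (c : Side → List (Fin n) → ℂ) (m : ℕ) (hm : m ≤ n) :
    historyWeight c chi (((List.finRange n).drop m).map fun t => (t, (fibre bm t).card))
        (arrangement chi (pending bm m))
      = (((List.finRange n).drop m).map fun t =>
          c (chi t) (blockWord chi (chi t) (fibre bm t))).prod := by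
  induction hm using Nat.decreasingInduction with
  | self =>
    rw [List.drop_eq_nil_of_le (by simp)]
    simp [historyWeight, length_arrangement, pending_last]
  | of_succ m hm ih =>
    have hdrop : (List.finRange n).drop m = ⟨m, hm⟩ :: (List.finRange n).drop (m + 1) := by
      rw [List.drop_eq_getElem_cons (by simpa using hm)]
      simp
    obtain ⟨h₁, h₂⟩ := popWord_popRest_arrangement hb hnc ⟨m, hm⟩
    rw [hdrop, List.map_cons, List.map_cons, List.prod_cons, historyWeight, length_arrangement,
      if_pos (card_fibre_le hb ⟨m, hm⟩), h₁, h₂, ih]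

theorem historyWeight_card_fibre (hb : IsBlockMax bm) (hnc : IsNoncrossing chi bm)
    (c : Side → List (Fin n) → ℂ) :
    historyWeight c chi ((List.finRange n).map fun t => (t, (fibre bm t).card)) []
      = ∏ t, c (chi t) (blockWord chi (chi t) (fibre bm t)) := by
  have h := historyWeight_arrangement hb hnc c 0 (Nat.zero_le n)
  have h0 : arrangement chi (∅ : Finset (Fin n)) = [] :=
    List.length_eq_zero_iff.1 (by simp [length_arrangement])
  rw [List.drop_zero, pending_zero, h0] at h
  rw [h, ← List.ofFn_eq_map, List.prod_ofFn]

/-- The counts alone govern the machine: inductively the contents agree at every time, hence so do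
the removed words, and `x` occurs in the word removed at time `bm x`. -/
theorem eq_of_card_fibre_eq {bm' : Fin n → Fin n} (hb : IsBlockMax bm)
    (hnc : IsNoncrossing chi bm) (hb' : IsBlockMax bm') (hnc' : IsNoncrossing chi bm')
    (h : ∀ m, (fibre bm m).card = (fibre bm' m).card) : bm = bm' := by
  have hp : ∀ m : ℕ, m ≤ n →
      arrangement chi (pending bm m) = arrangement chi (pending bm' m) := by
    intro m hm
    induction m with
    | zero => rw [pending_zero, pending_zero]
    | succ m ih =>
      rw [← (popWord_popRest_arrangement hb hnc ⟨m, hm⟩).2,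
        ← (popWord_popRest_arrangement hb' hnc' ⟨m, hm⟩).2, h, ih (by omega)]
  funext x
  have hx := (popWord_popRest_arrangement hb hnc (bm x)).1
  rw [h, hp _ (bm x).2.le, (popWord_popRest_arrangement hb' hnc' (bm x)).1] at hx
  have hmem : ∀ S : Finset (Fin n), x ∈ blockWord chi (chi (bm x)) S ↔ x ∈ S := by
    intro S
    cases chi (bm x) <;> simp [blockWord, mem_arrangement]
  exact (mem_fibre.1 ((hmem _).1 (hx ▸ (hmem _).2 (mem_fibre.2 rfl)))).symm

/-! ### Removal sequences -/

/-- The sequences of removals which can be carried out by the machine that inserts one letter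
before every removal, and which empty it. -/
def IsRemovalSequence (q : Fin n → ℕ) : Prop :=
  (∀ m, ∑ k ∈ Finset.Iic m, q k ≤ m + 1) ∧ ∑ k, q k = n

/-- The blocks completed up to time `m` consist of positions at most `m`, of which there are `m +
1`. -/
theorem isRemovalSequence_card_fibre (hb : IsBlockMax bm) :
    IsRemovalSequence fun m => (fibre bm m).card := by
  constructor
  · intro m
    have h := Finset.card_eq_sum_card_fiberwise (f := bm)
      (s := Finset.univ.filter fun x => bm x ≤ m) (t := Finset.Iic m) (by
        intro x hx
        simpa using hx)
    have h' : ∑ k ∈ Finset.Iic m, (fibre bm k).card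
        = (Finset.univ.filter fun x => bm x ≤ m).card := by
      rw [h]
      refine Finset.sum_congr rfl fun k hk => congrArg _ ?_
      ext x
      simp only [mem_fibre, Finset.mem_filter, Finset.mem_univ, true_and]
      rw [Finset.mem_Iic] at hk
      exact ⟨fun h => ⟨h ▸ hk, h⟩, fun h => h.2⟩
    rw [h', ← Fin.card_Iic]
    refine Finset.card_le_card fun x hx => ?_
    rw [Finset.mem_filter] at hx
    exact Finset.mem_Iic.2 ((hb.le x).trans hx.2)
  · have h := Finset.card_eq_sum_card_fiberwise (f := bm) (s := Finset.univ)
      (t := Finset.univ) (by simp)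
    rw [Finset.card_univ, Fintype.card_fin] at h
    exact h.symm

theorem removal_bounds_of_historyWeight_ne_zero {X : Type*} {c : Side → List X → ℂ}
    {side : X → Side} {L : List (X × ℕ)} {D : List X} (h : historyWeight c side L D ≠ 0) :
    (∀ m < L.length, ((L.take (m + 1)).map Prod.snd).sum ≤ D.length + m + 1) ∧
      (L.map Prod.snd).sum = D.length + L.length := by
  induction L generalizing D with
  | nil =>
    simp only [historyWeight, ne_eq, ite_eq_right_iff, Classical.not_imp] at h
    simp [h.1]
  | cons z L ih =>
    obtain ⟨x, p⟩ := z
    rw [historyWeight] at h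
    split_ifs at h with hp
    · obtain ⟨h₁, h₂⟩ := ih (right_ne_zero_of_mul h)
      rw [length_popRest, length_pushSide] at h₁ h₂
      constructor
      · intro m hm
        cases m with
        | zero => simpa using hp
        | succ m =>
          have := h₁ m (by simpa using hm)
          rw [List.take_succ_cons, List.map_cons, List.sum_cons]
          simp only
          omega
      · rw [List.map_cons, List.sum_cons, List.length_cons]
        simp only
        omega
    · exact absurd rfl h

theorem isRemovalSequence_of_historyWeight_ne_zero {c : Side → List (Fin n) → ℂ} {q : Fin n → ℕ}
    (h : historyWeight c chi ((List.finRange n).map fun t => (t, q t)) [] ≠ 0) :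
    IsRemovalSequence q := by
  obtain ⟨h₁, h₂⟩ := removal_bounds_of_historyWeight_ne_zero h
  have hmap : ((List.finRange n).map fun t => (t, q t)).map Prod.snd = List.ofFn q := by
    rw [List.map_map, List.ofFn_eq_map]
    rfl
  constructor
  · intro m
    have h := h₁ m (by simp)
    rw [List.map_take, hmap, List.sum_take_ofFn] at h
    refine le_trans (le_of_eq ?_) (h.trans (by simp))
    refine Finset.sum_congr ?_ fun _ _ => rfl
    ext k
    simp only [Finset.mem_Iic, Finset.mem_filter, Finset.mem_univ, true_and, Fin.le_def]
    omega
  · rw [hmap, List.sum_ofFn] at h₂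
    simpa using h₂

end Orders

/-! ### The deque device run forwards -/

section Device

variable {n : ℕ} (lam : LukPath n) (chi : Fin n → Side)

theorem dequeState_succ {t : ℕ} (ht : t < n) :
    dequeState lam chi (t + 1)
      = (dequeState lam chi t).move (lam.p ⟨t, ht⟩) (chi ⟨t, ht⟩) := by
  rw [dequeState, dif_pos ht]

theorem dequeState_input {t : ℕ} (ht : t ≤ n) :
    (dequeState lam chi t).input = (List.finRange n).drop (lam.inserted t) := by
  induction t with
  | zero => simp [dequeState, DequeState.init, LukPath.inserted_zero]
  | succ t ih =>
    rw [dequeState_succ lam chi ht, lam.inserted_succ ht, ← List.drop_drop, ← ih (by omega)]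
    cases chi ⟨t, ht⟩ <;> rfl

/-- The content of the deque in the middle of the move at time `t`, after the insertions. -/
def loadedAt (t : Fin n) : List (Fin n) :=
  (dequeState lam chi t).loaded (lam.p t) (chi t)

theorem mem_take_input {t b : Fin n} :
    b ∈ (dequeState lam chi t).input.take (lam.p t) ↔ b ∈ lam.group t := by
  have hs := lam.inserted_succ t.2
  change _ = _ + lam.p t at hs
  have hle := lam.inserted_mono (show t.val + 1 ≤ n by omega)
  rw [lam.inserted_last] at hle
  rw [dequeState_input lam chi t.2.le, LukPath.group, Finset.mem_filter,
    List.mem_iff_getElem]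
  simp only [List.getElem_take, List.getElem_drop, List.getElem_finRange, List.length_take,
    List.length_drop, List.length_finRange, Finset.mem_univ, true_and]
  constructor
  · rintro ⟨k, hk, rfl⟩
    simp only [Fin.val_cast]
    omega
  · rintro ⟨h₁, h₂⟩
    refine ⟨b.val - lam.inserted t, by omega, Fin.ext ?_⟩
    simp only [Fin.val_cast]
    omega

theorem loadedAt_ne_nil (t : Fin n) : loadedAt lam chi t ≠ [] := by
  intro h
  have h₀ := (dequeState_invariant lam chi t.2.le).2.2.length_eq
  have h₁ := (dequeState_invariant lam chi t.2.le).1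
  have h₂ := (dequeState_invariant lam chi t.2.le).2.1
  have h₃ := lam.lt_inserted t.2
  have h₄ := lam.inserted_succ t.2
  have h₅ := lam.inserted_mono (show t.val + 1 ≤ n by omega)
  rw [lam.inserted_last] at h₅
  change _ = _ + lam.p t at h₄
  have hlen := congrArg List.length h
  simp only [List.length_append, List.length_finRange] at h₀
  have : (loadedAt lam chi t).length =
      (dequeState lam chi t).deque.length + min (lam.p t) (dequeState lam chi t).input.length := by
    rw [loadedAt]
    cases chi t <;> simp [DequeState.loaded, add_comm]
  rw [this, List.length_nil] at hlen
  omega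

/-- The move at time `t` sends one ball to the output pipe. -/
theorem exists_output_ball (t : Fin n) : ∃ b,
    (dequeState lam chi (t + 1)).output = (dequeState lam chi t).output ++ [b] ∧
    (chi t = .left ∧ loadedAt lam chi t = b :: (dequeState lam chi (t + 1)).deque ∨
      chi t = .right ∧ loadedAt lam chi t = (dequeState lam chi (t + 1)).deque ++ [b]) := by
  have hne := loadedAt_ne_nil lam chi t
  rw [loadedAt] at hne ⊢
  rw [dequeState_succ lam chi t.2]
  cases h : chi t with
  | left =>
    rw [h] at hne
    refine ⟨_, ?_, Or.inl ⟨rfl, (List.cons_head_tail hne).symm⟩⟩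
    simp [DequeState.move, List.head?_eq_some_head hne]
  | right =>
    rw [h] at hne
    refine ⟨_, ?_, Or.inr ⟨rfl, (List.dropLast_append_getLast hne).symm⟩⟩
    simp [DequeState.move, List.getLast?_eq_some_getLast hne]

theorem dequeState_output_prefix {t : ℕ} (ht : t ≤ n) :
    (dequeState lam chi t).output <+: (dequeState lam chi n).output := by
  induction ht using Nat.decreasingInduction with
  | self => exact List.prefix_rfl
  | of_succ t ht ih =>
    obtain ⟨b, hb, -⟩ := exists_output_ball lam chi ⟨t, ht⟩
    refine List.IsPrefix.trans ?_ ih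
    rw [hb]
    exact List.prefix_append _ _

theorem dequeState_output {t : ℕ} (ht : t ≤ n) :
    (dequeState lam chi t).output = (dequeState lam chi n).output.take t := by
  have h := List.prefix_iff_eq_take.1 (dequeState_output_prefix lam chi ht)
  rwa [(dequeState_invariant lam chi ht).2.1] at h

/-- The time at which a ball arrives in the output pipe. -/
def outTime (b : Fin n) : Fin n :=
  ⟨(dequeState lam chi n).output.idxOf b, by
    obtain ⟨h₁, h₂⟩ := final_output lam chi
    have := List.idxOf_lt_length_of_mem (h₂.mem_iff.2 (List.mem_finRange b))
    omega⟩

theorem getElem?_output_eq_some_iff {t b : Fin n} :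
    (dequeState lam chi n).output[t.val]? = some b ↔ outTime lam chi b = t := by
  obtain ⟨h₁, h₂⟩ := final_output lam chi
  have hd : (dequeState lam chi n).output.Nodup := h₂.nodup_iff.2 (List.nodup_finRange n)
  have hmem : b ∈ (dequeState lam chi n).output := h₂.mem_iff.2 (List.mem_finRange b)
  constructor
  · intro h
    obtain ⟨ht, rfl⟩ := List.getElem?_eq_some_iff.1 h
    exact Fin.ext (hd.idxOf_getElem _ ht)
  · rintro rfl
    exact List.getElem?_idxOf hmem

theorem mem_output_iff {t : ℕ} (ht : t ≤ n) {b : Fin n} :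
    b ∈ (dequeState lam chi t).output ↔ (outTime lam chi b).val < t := by
  obtain ⟨h₁, h₂⟩ := final_output lam chi
  rw [dequeState_output lam chi ht]
  exact List.mem_take_iff_idxOf_lt (h₂.mem_iff.2 (List.mem_finRange b))

theorem outTime_injective : Function.Injective (outTime lam chi) := by
  intro a b h
  have h₁ := (getElem?_output_eq_some_iff lam chi).2 h
  rw [(getElem?_output_eq_some_iff lam chi).2 rfl] at h₁
  exact (Option.some_inj.1 h₁).symm

theorem outTime_surjective : Function.Surjective (outTime lam chi) :=
  Finite.surjective_of_injective (outTime_injective lam chi)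

theorem mem_outputTimes {i t : Fin n} :
    t ∈ outputTimes lam chi i ↔ ∃ b ∈ lam.group i, outTime lam chi b = t := by
  simp [outputTimes, getElem?_output_eq_some_iff]

theorem nodup_dequeState {t : ℕ} (ht : t ≤ n) :
    ((dequeState lam chi t).input ++ (dequeState lam chi t).deque ++
      (dequeState lam chi t).output).Nodup :=
  (dequeState_invariant lam chi ht).2.2.nodup_iff.2 (List.nodup_finRange n)

theorem le_outTime_of_mem_deque {t : ℕ} (ht : t ≤ n) {b : Fin n}
    (hb : b ∈ (dequeState lam chi t).deque) : t ≤ (outTime lam chi b).val := by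
  by_contra hlt
  rw [not_le, ← mem_output_iff lam chi ht] at hlt
  exact (List.nodup_append.1 (nodup_dequeState lam chi ht)).2.2 b
    (List.mem_append_right _ hb) b hlt rfl

theorem le_outTime_of_mem_group {t b : Fin n} (hb : b ∈ lam.group t) :
    t ≤ outTime lam chi b := by
  by_contra hlt
  rw [Fin.le_def, not_le, ← mem_output_iff lam chi t.2.le] at hlt
  rw [← mem_take_input lam chi] at hb
  exact (List.nodup_append.1 (nodup_dequeState lam chi t.2.le)).2.2 b
    (List.mem_append_left _ (List.mem_of_mem_take hb)) b hlt rfl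

theorem mem_deque_of_group {i j b : Fin n} (hji : j < i) (hb : b ∈ lam.group j)
    (hi : i ≤ outTime lam chi b) : b ∈ (dequeState lam chi i).deque := by
  have hmem := (dequeState_invariant lam chi i.2.le).2.2.mem_iff.2 (List.mem_finRange b)
  rw [List.mem_append, List.mem_append, mem_output_iff lam chi i.2.le] at hmem
  rcases hmem with (h | h) | h
  · rw [dequeState_input lam chi i.2.le, List.mem_iff_getElem] at h
    obtain ⟨k, hk, rfl⟩ := h
    have hm := lam.inserted_mono (show j.val + 1 ≤ i.val from hji)
    simp only [LukPath.group, Finset.mem_filter, List.getElem_drop, List.getElem_finRange,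
      Fin.val_cast] at hb
    omega
  · exact h
  · exact absurd h (not_lt.2 hi)

/-- The balls remaining after move `t` are output later than `t`. The forward key of a left time is
below the keys of all later times, that of a right time above them, which matches the end where the
ball leaves. -/
theorem pairwise_loadedAt_of_succ (t : Fin n)
    (h : (dequeState lam chi (t + 1)).deque.Pairwise fun a b =>
      fwdKey chi (outTime lam chi a) < fwdKey chi (outTime lam chi b)) :
    (loadedAt lam chi t).Pairwise fun a b =>
      fwdKey chi (outTime lam chi a) < fwdKey chi (outTime lam chi b) := by
  obtain ⟨b, hout, hb⟩ := exists_output_ball lam chi t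
  have hbt : outTime lam chi b = t := by
    have h₁ : b ∈ (dequeState lam chi (t + 1)).output := by simp [hout]
    rw [mem_output_iff lam chi t.2] at h₁
    have h₂ : b ∉ (dequeState lam chi t).output := by
      have := (List.nodup_append.1 (nodup_dequeState lam chi t.2)).2.1
      rw [hout, List.nodup_append] at this
      exact fun hmem => this.2.2 b hmem b (by simp) rfl
    rw [mem_output_iff lam chi t.2.le] at h₂
    exact Fin.ext (by omega)
  rcases hb with ⟨hc, hb⟩ | ⟨hc, hb⟩
  · rw [hb, List.pairwise_cons]
    refine ⟨fun a ha => ?_, h⟩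
    have hle := le_outTime_of_mem_deque lam chi t.2 ha
    rw [hbt, fwdKey_of_left chi hc]
    rcases (chi (outTime lam chi a)).eq_left_or_eq_right with h' | h'
    · rw [fwdKey_of_left chi h']
      omega
    · rw [fwdKey_of_right chi h']
      omega
  · rw [hb, List.pairwise_append]
    refine ⟨h, List.pairwise_singleton _ _, fun a ha b' hb' => ?_⟩
    rw [List.mem_singleton] at hb'
    subst hb'
    have hle := le_outTime_of_mem_deque lam chi t.2 ha
    rw [hbt, fwdKey_of_right chi hc]
    rcases (chi (outTime lam chi a)).eq_left_or_eq_right with h' | h'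
    · rw [fwdKey_of_left chi h']
      omega
    · rw [fwdKey_of_right chi h']
      omega

theorem deque_sublist_loadedAt (t : Fin n) :
    (dequeState lam chi t).deque.Sublist (loadedAt lam chi t) := by
  rw [loadedAt]
  cases chi t
  · exact List.sublist_append_right _ _
  · exact List.sublist_append_left _ _

/-- The order is propagated backwards in time from the empty final deque: undoing the output at `t`
preserves it, and undoing the insertions passes to a sublist. -/
theorem pairwise_deque {t : ℕ} (ht : t ≤ n) :
    (dequeState lam chi t).deque.Pairwise fun a b =>
      fwdKey chi (outTime lam chi a) < fwdKey chi (outTime lam chi b) := by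
  induction ht using Nat.decreasingInduction with
  | self =>
    have h₀ := (dequeState_invariant lam chi le_rfl).2.2.length_eq
    have h₁ := (dequeState_invariant lam chi le_rfl).2.1
    simp only [List.length_append, List.length_finRange] at h₀
    rw [List.length_eq_zero_iff.1 (show (dequeState lam chi n).deque.length = 0 by omega)]
    exact List.Pairwise.nil
  | of_succ t ht ih =>
    exact (pairwise_loadedAt_of_succ lam chi ⟨t, ht⟩ ih).sublist
      (deque_sublist_loadedAt lam chi ⟨t, ht⟩)

/-- A ball of an earlier group is never output between two balls of a later group, with respect
to the forward order on the output times. -/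
theorem not_between_group {i j a b c : Fin n} (hji : j < i) (ha : a ∈ lam.group i)
    (hc : c ∈ lam.group i) (hb : b ∈ lam.group j)
    (hab : fwdKey chi (outTime lam chi a) < fwdKey chi (outTime lam chi b))
    (hbc : fwdKey chi (outTime lam chi b) < fwdKey chi (outTime lam chi c)) : False := by
  have hia := le_outTime_of_mem_group lam chi ha
  have hic := le_outTime_of_mem_group lam chi hc
  -- If `b` is still in the deque when the group of `i` arrives, that group is inserted entirely on
  -- one side of `b`.
  by_cases hib : i ≤ outTime lam chi b
  · have hbd := mem_deque_of_group lam chi hji hb hib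
    have hpw := pairwise_loadedAt_of_succ lam chi i (pairwise_deque lam chi i.2)
    rw [← mem_take_input lam chi] at ha hc
    rw [loadedAt] at hpw
    cases h : chi i with
    | left =>
      rw [h, DequeState.loaded, List.pairwise_append] at hpw
      exact lt_asymm hbc (hpw.2.2 c (List.mem_reverse.2 hc) b hbd)
    | right =>
      rw [h, DequeState.loaded, List.pairwise_append] at hpw
      exact lt_asymm hab (hpw.2.2 b hbd a ha)
  -- Otherwise `b` leaves before both `a` and `c`, so its forward key is below both or above both.
  · rw [Fin.le_def] at hia hic hib
    rcases (chi (outTime lam chi b)).eq_left_or_eq_right with h | h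
    · rw [fwdKey_of_left chi h] at hab
      rcases (chi (outTime lam chi a)).eq_left_or_eq_right with h' | h'
      · rw [fwdKey_of_left chi h'] at hab
        omega
      · rw [fwdKey_of_right chi h'] at hab
        omega
    · rw [fwdKey_of_right chi h] at hbc
      rcases (chi (outTime lam chi c)).eq_left_or_eq_right with h' | h'
      · rw [fwdKey_of_left chi h'] at hbc
        omega
      · rw [fwdKey_of_right chi h'] at hbc
        omega

/-! ### Recovering the path from its partition -/

theorem card_group (i : Fin n) : (lam.group i).card = lam.p i := by
  have hs := lam.inserted_succ i.2
  change _ = _ + lam.p i at hs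
  have hle := lam.inserted_mono (show i.val + 1 ≤ n by omega)
  rw [lam.inserted_last] at hle
  have h : (lam.group i).map Fin.valEmbedding
      = Finset.Ico (lam.inserted i) (lam.inserted (i + 1)) := by
    ext b
    simp only [LukPath.group, Finset.mem_map, Finset.mem_filter, Finset.mem_univ, true_and,
      Fin.valEmbedding_apply, Finset.mem_Ico]
    constructor
    · rintro ⟨a, ha, rfl⟩
      exact ha
    · intro hb
      exact ⟨⟨b, by omega⟩, hb, rfl⟩
  rw [← Finset.card_map Fin.valEmbedding, h, Nat.card_Ico]
  omega

theorem card_outputTimes (i : Fin n) : (outputTimes lam chi i).card = lam.p i := by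
  have h : outputTimes lam chi i = (lam.group i).image (outTime lam chi) := by
    ext t
    simp [mem_outputTimes]
  rw [h, Finset.card_image_of_injective _ (outTime_injective lam chi), card_group]

theorem le_of_mem_outputTimes {i t : Fin n} (h : t ∈ outputTimes lam chi i) : i ≤ t := by
  obtain ⟨b, hb, rfl⟩ := (mem_outputTimes lam chi).1 h
  exact le_outTime_of_mem_group lam chi hb

/-- The output of move `i` takes place at the end where balls were just inserted, so if there were
any, the ball leaving is one of them. -/
theorem self_mem_outputTimes {i : Fin n} (hi : 0 < lam.p i) : i ∈ outputTimes lam chi i := by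
  obtain ⟨b, hbi⟩ := outTime_surjective lam chi i
  refine (mem_outputTimes lam chi).2 ⟨b, ?_, hbi⟩
  obtain ⟨b', hout, hb'⟩ := exists_output_ball lam chi i
  have hbb : b = b' := by
    have h₁ : b ∈ (dequeState lam chi (i + 1)).output := by
      rw [mem_output_iff lam chi i.2, hbi]
      omega
    have h₂ : b ∉ (dequeState lam chi i).output := by
      rw [mem_output_iff lam chi i.2.le, hbi]
      omega
    rw [hout, List.mem_append, List.mem_singleton] at h₁
    exact h₁.resolve_left h₂
  subst hbb
  rw [← mem_take_input lam chi]
  obtain ⟨x, hx⟩ := lam.group_nonempty_iff.2 hi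
  rw [← mem_take_input lam chi] at hx
  have hne := List.ne_nil_of_mem hx
  rcases hb' with ⟨hc, hb'⟩ | ⟨hc, hb'⟩
  · rw [loadedAt, hc, DequeState.loaded] at hb'
    obtain ⟨y, l, hyl⟩ := List.exists_cons_of_ne_nil (List.reverse_ne_nil_iff.2 hne)
    rw [hyl, List.cons_append, List.cons.injEq] at hb'
    rw [← List.mem_reverse, hyl, hb'.1]
    exact List.mem_cons_self
  · rw [loadedAt, hc, DequeState.loaded] at hb'
    rw [← List.dropLast_append_getLast hne, ← List.append_assoc] at hb'
    have := (List.append_inj' hb' rfl).2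
    rw [List.singleton_inj] at this
    rw [← this]
    exact List.getLast_mem hne

theorem mem_parts_outputTimePartition {T : Finset (Fin n)} :
    T ∈ (outputTimePartition chi lam).parts ↔ ∃ i, 0 < lam.p i ∧ outputTimes lam chi i = T := by
  change T ∈ Finset.image _ _ ↔ _
  simp

theorem LukPath.ext_p {lam lam' : LukPath n} (h : ∀ i, lam.p i = lam'.p i) : lam = lam' := by
  have hr : lam.rise = lam'.rise := by
    funext i
    have h₁ := lam.cast_p i
    have h₂ := lam'.cast_p i
    have h₃ := h i
    omega
  cases lam
  cases lam'
  cases hr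
  rfl

/-- Each block recovers its index `i` as its minimum and `p_i` as its cardinality; the indices which
are not block minima have `p_i = 0`. -/
theorem outputTimePartition_injective : Function.Injective (outputTimePartition chi) := by
  have key : ∀ lam lam' : LukPath n, outputTimePartition chi lam = outputTimePartition chi lam' →
      ∀ i, 0 < lam.p i → lam.p i = lam'.p i := by
    intro lam lam' h i hi
    have hT := (mem_parts_outputTimePartition lam chi).2 ⟨i, hi, rfl⟩
    rw [h, mem_parts_outputTimePartition] at hT
    obtain ⟨j, hj, hji⟩ := hT
    have h₁ := self_mem_outputTimes lam chi hi
    have h₂ := self_mem_outputTimes lam' chi hj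
    have hij : i = j := le_antisymm (le_of_mem_outputTimes lam chi (hji ▸ h₂))
      (le_of_mem_outputTimes lam' chi (hji.symm ▸ h₁))
    subst hij
    rw [← card_outputTimes lam chi, ← hji, card_outputTimes]
  intro lam lam' h
  refine LukPath.ext_p fun i => ?_
  rcases Nat.eq_zero_or_pos (lam.p i) with h₁ | h₁
  · rcases Nat.eq_zero_or_pos (lam'.p i) with h₂ | h₂
    · rw [h₁, h₂]
    · exact (key lam' lam h.symm i h₂).symm
  · exact key lam lam' h i h₁

end Device

/-! ### Blocks of a partition and their maxima -/

section Blocks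

variable {n : ℕ}

/-- The maximum of the block of a partition which contains a given position. -/
def blockMax (π : Finpartition (Finset.univ : Finset (Fin n))) (x : Fin n) : Fin n :=
  (π.part x).max' ⟨x, π.mem_part (Finset.mem_univ x)⟩

variable (π : Finpartition (Finset.univ : Finset (Fin n)))

theorem blockMax_mem_part (x : Fin n) : blockMax π x ∈ π.part x :=
  Finset.max'_mem _ _

theorem part_blockMax (x : Fin n) : π.part (blockMax π x) = π.part x :=
  (π.mem_part_iff_part_eq_part (Finset.mem_univ _) (Finset.mem_univ _)).1 (blockMax_mem_part π x)

theorem blockMax_eq_iff {x y : Fin n} : blockMax π x = blockMax π y ↔ π.part x = π.part y := by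
  constructor
  · intro h
    rw [← part_blockMax π x, h, part_blockMax]
  · intro h
    simp only [blockMax, h]

theorem isBlockMax_blockMax : IsBlockMax (blockMax π) where
  le x := Finset.le_max' _ _ (π.mem_part (Finset.mem_univ x))
  idem x := (blockMax_eq_iff π).2 (part_blockMax π x)

theorem fibre_blockMax_self (x : Fin n) : fibre (blockMax π) (blockMax π x) = π.part x := by
  ext y
  rw [mem_fibre, blockMax_eq_iff,
    π.mem_part_iff_part_eq_part (Finset.mem_univ _) (Finset.mem_univ _)]

theorem parts_eq_image_fibre :
    π.parts = (Finset.univ.filter fun m => (fibre (blockMax π) m).Nonempty).image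
      (fibre (blockMax π)) := by
  ext T
  simp only [Finset.mem_image, Finset.mem_filter, Finset.mem_univ, true_and]
  constructor
  · intro hT
    obtain ⟨x, hx⟩ := π.nonempty_of_mem_parts hT
    have h : fibre (blockMax π) (blockMax π x) = T := by
      rw [fibre_blockMax_self, π.part_eq_of_mem hT hx]
    exact ⟨blockMax π x, h ▸ ⟨x, hx⟩, h⟩
  · rintro ⟨m, ⟨x, hx⟩, rfl⟩
    rw [mem_fibre] at hx
    rw [← hx, fibre_blockMax_self]
    exact π.part_mem.2 (Finset.mem_univ x)

theorem blockMax_injective :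
    Function.Injective (blockMax : Finpartition (Finset.univ : Finset (Fin n)) → _) := by
  intro π π' h
  apply Finpartition.ext
  rw [parts_eq_image_fibre, parts_eq_image_fibre, h]

/-- The machine yields one factor per position, the theorem one per block. Blocks are indexed by
their maxima, and every other position has an empty fibre and must contribute `1`. -/
theorem prod_parts_eq_prod_fibre {M : Type*} [CommMonoid M] (F : Finset (Fin n) → M)
    (G : Fin n → M) (hF : ∀ m, (fibre (blockMax π) m).Nonempty → F (fibre (blockMax π) m) = G m)
    (hG : ∀ m, ¬ (fibre (blockMax π) m).Nonempty → G m = 1) :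
    ∏ T ∈ π.parts, F T = ∏ m, G m := by
  rw [parts_eq_image_fibre, Finset.prod_image, Finset.prod_filter]
  · refine Finset.prod_congr rfl fun m _ => ?_
    split_ifs with h
    · exact hF m h
    · exact (hG m h).symm
  · intro m hm m' _ h
    obtain ⟨x, hx⟩ := (Finset.mem_filter.1 hm).2
    have hx' := hx
    rw [h] at hx'
    rw [mem_fibre] at hx hx'
    rw [← hx, hx']

/-- In a crossing of two different groups, some ball of the earlier group would be output between
two balls of the later one, against `not_between_group`. -/
theorem isNoncrossing_outputTimePartition (chi : Fin n → Side) (lam : LukPath n) :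
    IsNoncrossing chi (blockMax (outputTimePartition chi lam)) := by
  have hown : ∀ x, ∃ i, 0 < lam.p i ∧ ∃ b ∈ lam.group i, outTime lam chi b = x := by
    intro x
    obtain ⟨b, hb⟩ := outTime_surjective lam chi x
    obtain ⟨i, hi⟩ := lam.exists_group b
    exact ⟨i, lam.group_nonempty_iff.1 ⟨b, hi⟩, b, hi, hb⟩
  have hsame : ∀ x y i, (∃ b ∈ lam.group i, outTime lam chi b = x) → 0 < lam.p i →
      (blockMax (outputTimePartition chi lam) x = blockMax (outputTimePartition chi lam) y ↔
        ∃ b ∈ lam.group i, outTime lam chi b = y) := by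
    intro x y i hx hi
    have hT := (mem_parts_outputTimePartition lam chi).2 ⟨i, hi, rfl⟩
    rw [← mem_outputTimes lam chi] at hx ⊢
    rw [blockMax_eq_iff, Finpartition.part_eq_of_mem _ hT hx, eq_comm,
      Finpartition.part_eq_iff_mem _ hT]
  intro a b c d hab hbc hcd hac hbd
  obtain ⟨i, hi, hai⟩ := hown a
  obtain ⟨j, hj, hbj⟩ := hown b
  have hci := (hsame a c i hai hi).1 hac
  have hdj := (hsame b d j hbj hj).1 hbd
  rcases lt_trichotomy i j with h | h | h
  · obtain ⟨b, hb, rfl⟩ := hbj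
    obtain ⟨c, hc, rfl⟩ := hci
    obtain ⟨d, hd, rfl⟩ := hdj
    exact (not_between_group lam chi h hb hd hc hbc hcd).elim
  · subst h
    exact (hsame a b i hai hi).2 hbj
  · obtain ⟨a, ha, rfl⟩ := hai
    obtain ⟨b, hb, rfl⟩ := hbj
    obtain ⟨c, hc, rfl⟩ := hci
    exact (not_between_group lam chi h ha hc hb hab hbc).elim

end Blocks

/-! ### Bi-mixtures of blocks -/

section BiMixture

variable {d n : ℕ}

theorem map_occurrences_restrictTuple (omega : Fin n → Fin d) (chi : Fin n → Side)
    (T : Finset (Fin n)) (h : Side) :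
    (occurrences (restrictTuple chi T) h).map (restrictTuple omega T)
      = ((List.finRange n).filter fun x => x ∈ T ∧ chi x = h).map omega := by
  have hmap : (occurrences (restrictTuple chi T) h).map (T.orderEmbOfFin rfl)
      = (List.finRange n).filter fun x => x ∈ T ∧ chi x = h := by
    refine eq_of_pairwise_key_lt (fun x : Fin n => (x.val : ℤ)) ?_ ?_ fun x => ?_
    · rw [occurrences, List.pairwise_map]
      refine ((List.pairwise_lt_finRange _).filter _).imp fun {a b} hab => ?_
      have := (T.orderEmbOfFin rfl).strictMono hab
      simp only [Nat.cast_lt]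
      exact this
    · refine ((List.pairwise_lt_finRange n).filter _).imp fun {a b} hab => ?_
      simpa using hab
    · simp only [occurrences, List.mem_map, List.mem_filter, List.mem_finRange, true_and,
        decide_eq_true_eq]
      constructor
      · rintro ⟨k, hk, rfl⟩
        exact ⟨T.orderEmbOfFin_mem rfl k, hk⟩
      · rintro ⟨hx, hxh⟩
        obtain ⟨k, rfl⟩ : x ∈ Set.range (T.orderEmbOfFin rfl) := by
          rw [Finset.range_orderEmbOfFin]
          exact hx
        exact ⟨k, hxh, rfl⟩
  rw [← hmap, List.map_map]
  rfl

/-- A form applicable to lengths such as `T.card`, which are positive but not given as successors.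
-/
theorem biMixture_of_pos (f g : FreeAlgebra ℂ (Fin d)) (hn : 0 < n) (omega : Fin n → Fin d)
    (chi : Fin n → Side) :
    biMixture f g omega chi =
      match chi ⟨n - 1, by omega⟩ with
      | .left =>
          coeffAt f (((occurrences chi .right).reverse ++ occurrences chi .left).map omega)
      | .right =>
          coeffAt g (((occurrences chi .left).reverse ++ occurrences chi .right).map omega) := by
  cases n with
  | zero => omega
  | succ n => rfl

/-- The maximum of `T` carries the last symbol of the restricted bi-word, so the side of removal
selects `f` or `g` exactly as the bi-mixture does. -/
theorem biMixture_restrictTuple (f g : FreeAlgebra ℂ (Fin d)) (omega : Fin n → Fin d)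
    (chi : Fin n → Side) (T : Finset (Fin n)) (m : Fin n) (hm : m ∈ T) (hmax : ∀ x ∈ T, x ≤ m) :
    biMixture f g (restrictTuple omega T) (restrictTuple chi T)
      = symbolCoeff f g (chi m) ((blockWord chi (chi m) T).map omega) := by
  have hpos : 0 < T.card := Finset.card_pos.2 ⟨m, hm⟩
  have hlast : restrictTuple chi T ⟨T.card - 1, by omega⟩ = chi m := by
    rw [restrictTuple, Finset.orderEmbOfFin_last rfl hpos]
    congr 1
    exact le_antisymm (hmax _ (Finset.max'_mem _ _)) (Finset.le_max' _ _ hm)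
  have hlen : ((blockWord chi (chi m) T).map omega).length ≠ 0 := by
    cases chi m <;> simpa [blockWord, ← length_arrangement chi] using hpos.ne'
  rw [biMixture_of_pos f g hpos, hlast, symbolCoeff, if_neg hlen]
  cases chi m with
  | left =>
    simp only [List.map_append, List.map_reverse, map_occurrences_restrictTuple, symbolOf,
      blockWord, arrangement, List.reverse_append, List.reverse_reverse]
  | right =>
    simp only [List.map_append, List.map_reverse, map_occurrences_restrictTuple, symbolOf,
      blockWord, arrangement]

end BiMixture

/-! ### Counting -/

section Counting

variable {n : ℕ}

/-- The reversal of a removal sequence is a Lukasiewicz path. -/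
theorem IsRemovalSequence.exists_lukPath {q : Fin n → ℕ} (hq : IsRemovalSequence q) :
    ∃ lam : LukPath n, ∀ i, lam.p i = q i.rev := by
  obtain ⟨h₁, h₂⟩ := hq
  have hrev : ∑ k, q (Fin.rev k) = n := by
    refine Eq.trans ?_ h₂
    exact Fintype.sum_equiv Fin.revPerm _ _ fun _ => rfl
  have hsum : ∀ s : Finset (Fin n),
      ∑ k ∈ s, ((q k.rev : ℤ) - 1) = ((∑ k ∈ s, q k.rev : ℕ) : ℤ) - s.card := by
    intro s
    rw [Finset.sum_sub_distrib]
    simp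
  refine ⟨⟨fun i => (q i.rev : ℤ) - 1, fun m => by omega, fun m => ?_, ?_⟩, fun i => ?_⟩
  · rw [hsum, Fin.card_Iic]
    have hsplit : ∑ k ∈ Finset.Iic m, q k.rev + ∑ k ∈ Finset.Ioi m, q k.rev = n := by
      refine Eq.trans ?_ hrev
      rw [← Finset.sum_union]
      · refine Finset.sum_congr ?_ fun _ _ => rfl
        ext k
        simp [le_or_gt]
      · rw [Finset.disjoint_left]
        intro k hk hk'
        rw [Finset.mem_Iic] at hk
        rw [Finset.mem_Ioi] at hk'
        exact absurd hk (not_le.2 hk')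
    -- Under reversal the indices after `m` become the first `n - (m + 1)` times of `q`, where the
    -- removals are bounded by the insertions. If `m` is the last index there are none, and no bound
    -- from `q` can be invoked.
    have htail : ∑ k ∈ Finset.Ioi m, q k.rev ≤ n - (m + 1) := by
      by_cases hm : m.val + 1 = n
      · have : Finset.Ioi m = ∅ := by
          ext k
          simp only [Finset.mem_Ioi, Fin.lt_def, Finset.notMem_empty, iff_false]
          omega
        simp [this]
      · have h := h₁ ⟨n - (m + 1) - 1, by omega⟩
        have heq : ∑ k ∈ Finset.Ioi m, q k.rev
            = ∑ k ∈ Finset.Iic (⟨n - (m + 1) - 1, by omega⟩ : Fin n), q k := by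
          refine Finset.sum_nbij' Fin.rev Fin.rev ?_ ?_ (by simp) (by simp) (by simp)
          · intro k hk
            rw [Finset.mem_Ioi, Fin.lt_def] at hk
            rw [Finset.mem_Iic, Fin.le_def, Fin.val_rev]
            simp only
            omega
          · intro k hk
            rw [Finset.mem_Iic, Fin.le_def] at hk
            rw [Finset.mem_Ioi, Fin.lt_def, Fin.val_rev]
            simp only at hk
            omega
        rw [heq]
        refine h.trans ?_
        simp only
        omega
    omega
  · rw [hsum, hrev]
    simp
  · simp [LukPath.p]

theorem mem_dequePartitions {chi : Fin n → Side}
    {π : Finpartition (Finset.univ : Finset (Fin n))} :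
    π ∈ dequePartitions chi ↔ ∃ lam, outputTimePartition chi lam = π := by
  simp [dequePartitions]

/-- Reversal gives distinct paths for distinct removal sequences, and distinct paths have distinct
partitions. This map serves only for counting; it is not the correspondence used in the sum. -/
theorem card_isRemovalSequence_le (chi : Fin n → Side) (V : Finset (Fin n → Fin (n + 1)))
    (hV : ∀ q ∈ V, IsRemovalSequence fun m => (q m : ℕ)) :
    V.card ≤ (dequePartitions chi).card := by
  choose F hF using fun q : V => (hV q.1 q.2).exists_lukPath
  have hinj : Function.Injective fun q : V =>
      (⟨outputTimePartition chi (F q), mem_dequePartitions.2 ⟨_, rfl⟩⟩ : dequePartitions chi) := by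
    intro q q' h
    have hFq := outputTimePartition_injective chi (Subtype.ext_iff.1 h)
    refine Subtype.ext (funext fun i => Fin.ext ?_)
    have h₁ := hF q i.rev
    have h₂ := hF q' i.rev
    rw [Fin.rev_rev] at h₁ h₂
    rw [← h₁, ← h₂, hFq]
  simpa using Fintype.card_le_of_injective _ hinj

theorem sum_historyWeight (c : Side → List (Fin n) → ℂ) (chi : Fin n → Side) :
    ∑ q : Fin n → Fin (n + 1),
        historyWeight c chi ((List.finRange n).map fun t => (t, (q t : ℕ))) []
      = ∑ π ∈ dequePartitions chi,
          ∏ t, c (chi t) (blockWord chi (chi t) (fibre (blockMax π) t)) := by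
  classical
  have hnc : ∀ π ∈ dequePartitions chi, IsNoncrossing chi (blockMax π) := by
    intro π hπ
    obtain ⟨lam, rfl⟩ := mem_dequePartitions.1 hπ
    exact isNoncrossing_outputTimePartition chi lam
  let removals (π : Finpartition (Finset.univ : Finset (Fin n))) : Fin n → Fin (n + 1) :=
    fun m => ⟨(fibre (blockMax π) m).card, Nat.lt_succ_of_le (card_finset_fin_le _)⟩
  have hinj : Set.InjOn removals (dequePartitions chi : Set _) := by
    intro π hπ π' hπ' h
    exact blockMax_injective (eq_of_card_fibre_eq (isBlockMax_blockMax π) (hnc π hπ)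
      (isBlockMax_blockMax π') (hnc π' hπ') fun m => congrArg Fin.val (congrFun h m))
  -- Surjectivity onto the removal sequences is obtained by cardinality, from the injection in one
  -- direction and `card_isRemovalSequence_le` in the other.
  have hV : (dequePartitions chi).image removals
      = Finset.univ.filter fun q : Fin n → Fin (n + 1) =>
          IsRemovalSequence fun m => (q m : ℕ) := by
    refine Finset.eq_of_subset_of_card_le ?_ ?_
    · intro q hq
      obtain ⟨π, -, rfl⟩ := Finset.mem_image.1 hq
      exact Finset.mem_filter.2
        ⟨Finset.mem_univ _, isRemovalSequence_card_fibre (isBlockMax_blockMax π)⟩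
    · rw [Finset.card_image_of_injOn hinj]
      exact card_isRemovalSequence_le chi _ fun q hq => (Finset.mem_filter.1 hq).2
  rw [← Finset.sum_subset (Finset.filter_subset
    (fun q : Fin n → Fin (n + 1) => IsRemovalSequence fun m => (q m : ℕ)) Finset.univ), ← hV,
    Finset.sum_image hinj]
  · exact Finset.sum_congr rfl fun π hπ =>
      historyWeight_card_fibre (isBlockMax_blockMax π) (hnc π hπ) c
  · intro q _ hq
    by_contra h
    exact hq (Finset.mem_filter.2
      ⟨Finset.mem_univ _, isRemovalSequence_of_historyWeight_ne_zero h⟩)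

end Counting

end DequeFock

theorem proposition6p10 {d : ℕ} (f g : FreeAlgebra ℂ (Fin d))
    (hf : coeffAt f [] = 0) (hg : coeffAt g [] = 0)
    {n : ℕ} (hn : 0 < n) (omega : Fin n → Fin d) (chi : Fin n → Side) :
    vacuumState (List.ofFn fun k => canonicalOp f g (omega k) (chi k)).prod =
      ∑ π ∈ dequePartitions chi,
        ∏ T ∈ π.parts, biMixture f g (restrictTuple omega T) (restrictTuple chi T) := by
  rw [vacuumState_eq_sum_historyWeight hf hg, sum_historyWeight]
  refine Finset.sum_congr rfl fun π _ => (prod_parts_eq_prod_fibre π _ _ ?_ ?_).symm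
  · rintro m ⟨x, hx⟩
    have hb := isBlockMax_blockMax π
    rw [mem_fibre] at hx
    refine biMixture_restrictTuple f g omega chi _ m (mem_fibre.2 (hx ▸ hb.idem x)) fun y hy => ?_
    exact mem_fibre.1 hy ▸ hb.le y
  · intro m hm
    have : fibre (blockMax π) m = ∅ := Finset.not_nonempty_iff_eq_empty.1 hm
    -- A time that is not a block maximum removes the empty word, whose coefficient is the `1` of
    -- the identity operator.
    rw [symbolCoeff, if_pos]
    rw [this]
    cases chi m <;> simp [blockWord, length_arrangement]
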